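/- **Setting.** Let $d\ge 1$, $\alpha>0$, $L>0$, $\sigma>0$, and let $l$ be the largest integer strictly smaller than $\alpha$. For a multi-index $s\in\mathbb N^d$ put $|s|=\sum_i s_i$, $s!=\prod_i s_i!$, $x^s=\prod_i x_i^{s_i}$, and let $D^s$ be the corresponding partial derivative. The Hölder class $\Sigma(\alpha,L)$ on $\mathcal X=[0,1]^d$ consists of the functions $f:\mathcal X\to\mathbb R$ that are $l$ times continuously differentiable and satisfy, for all $x,y\in\mathcal X$, $$D^sf(x)-D^sf(y)\le L\|x-y\|_\infty^{\alpha-l}\quad(|s|=l),\qquad \Big|f(x)-\sum_{|s|\le l}\frac{(x-y)^s}{s!}D^sf(y)\Big|\le L\|x-y\|_\infty^{\alpha}.$$ Assume $\|f\|_\infty\le 1$ and $f\in\Sigma(\alpha,L)$. A query at $x\in\mathcal X$ returns $y=f(x)+\eta$, where the noise variables are i.i.d., centred and sub-Gaussian with parameter $\sigma$, and each of them is independent of everything the learner knows when choosing its query. Let $x^*\in\arg\max_{\mathcal X}f$; the pseudo-regret of queries $x_1,\dots,x_T$ is $R(T)=\sum_{t=1}^T[f(x^*)-f(x_t)]$.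 Let $r=\max(l,1)$, let $\phi(x)=(x^s)_{|s|\le r}$ (the constant monomial is the intercept), and let $d'=|\{s:1\le|s|\le r\}|$, so that $d'=d$ if $\alpha\le 2$. **UCB-Meta-algorithm** with $n=N^d$ bins ($N\geq 1$ an integer), fail probability $\delta$ and $\varepsilon=Ln^{-\alpha/d}$. Divide $\mathcal X$ into $n$ equal closed cubes $B_1,\dots,B_n$ of side $1/N$. If bin $B_k$ has been queried $t$ times so far, at points $x_1,\dots,x_t\in B_k$ with observations $y_1,\dots,y_t$, put $A=I+\sum_{j\le t}\phi(x_j)\phi(x_j)^\top$, $\hat\theta=A^{-1}\sum_{j\le t}y_j\phi(x_j)$, $\beta=128\sigma^2d'\ln(1+t)\ln\!\big(4(t+1)^2/(\delta/n)\big)$ and $$UCB_k(x)=\langle\phi(x),\hat\theta\rangle+\sqrt{\beta}\,\|A^{-1/2}\phi(x)\|_2+\varepsilon\sum_{j\le t}|\phi(x)^\top A^{-1}\phi(x_j)|.$$ The algorithm first queries every bin once, at an arbitrary (possibly random) point of it. Then, in each of $T$ rounds, it selects a bin $B_k$ for which $\max_{x\in B_k}UCB_k(x)$ is largest and queries a maximizer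 of $UCB_k$ over $B_k$ (ties are broken arbitrarily). **Theorem.** (1) There is a constant $C>0$, depending only on $\alpha,L,\sigma$, such that for all $d\ge1$, $N\ge 1$, $n=N^d$, $T\ge2$, $\delta\in(0,1)$ and all $f$ as above, with probability at least $1-\delta$, $$R(T)\le C\Big(d'\ln T\,\sqrt{Tn\ln(T^2n/\delta)}+d'\,\varepsilon\,T\sqrt{\ln T}\Big),\qquad \varepsilon=Ln^{-\alpha/d},$$ where $R(T)$ is the pseudo-regret of the $T$ rounds; if $n\le T$, then on the same event the bound also holds when the regret of the $n$ initial queries is added. (2) For all $c_1,c_2>0$ there is a constant $C>0$, depending only on $\alpha,L,\sigma,c_1,c_2$, such that for all $d,N,T,\delta,f$ as in (1) with $c_1\,(T/\ln^2T)^{1/(d+2\alpha)}\le N$ and $n=N^d\le c_2\,(T/\ln^2T)^{d/(d+2\alpha)}$ (that is, $n$ is of order $T^{d/(d+2\alpha)}/\ln(T)^{2d/(d+2\alpha)}$), with probability at least $1-\delta$ the pseudo-regret of all $n+T$ queries is at most $$C\,d'\,T^{\frac{d+\alpha}{d+2\alpha}}\,(\ln T)^{\frac{2\alpha}{d+2\alpha}}\sqrt{\ln(T/\delta)}=\tilde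 O\big(d'\,T^{\frac{d+\alpha}{d+2\alpha}}\big).$$ -/

import Mathlib

open MeasureTheory ProbabilityTheory
open scoped NNReal ENNReal Matrix

noncomputable section

namespace HolderBandit

/-! ### The Hölder class on the unit cube -/

/-- The domain `[0,1]^d`. The norm of `Fin d → ℝ` is the sup norm. -/
def cube (d : ℕ) : Set (Fin d → ℝ) := Set.Icc 0 1

/-- The largest integer strictly smaller than `α` (for `α > 0`). -/
def holderOrder (α : ℝ) : ℕ := ⌈α⌉₊ - 1

/-- Monomial `x^s = ∏ i, x_i ^ s_i` for a multi-index `s`. -/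
def monomial {d : ℕ} (s : Fin d → ℕ) (x : Fin d → ℝ) : ℝ := ∏ i, x i ^ s i

/-- The multi-indices `s` with `|s| ≤ r`. -/
def multiIndices (d r : ℕ) : Finset (Fin d → ℕ) :=
  (Finset.range (r + 1)).biUnion fun j => Finset.piAntidiag Finset.univ j

/-- The partial derivative `D^s f` on the cube: the derivative of order `|s|`, evaluated at
`s_i` copies of the `i`-th basis vector for each `i`. -/
def partialDeriv {d : ℕ} (s : Fin d → ℕ) (f : (Fin d → ℝ) → ℝ) (x : Fin d → ℝ) : ℝ :=
  iteratedFDerivWithin ℝ (∑ i, s i) f (cube d) x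
    fun j => Pi.single (finSigmaFinEquiv.symm j).1 (1 : ℝ)

/-- The Taylor polynomial of degree `l` of `f` around `y`, evaluated at `x`. -/
def taylorPoly {d : ℕ} (l : ℕ) (f : (Fin d → ℝ) → ℝ) (y x : Fin d → ℝ) : ℝ :=
  ∑ s ∈ multiIndices d l,
    monomial s (x - y) / ((∏ i, (s i).factorial : ℕ) : ℝ) * partialDeriv s f y

/-- The Hölder class `Σ(α, L)` on `[0,1]^d`. -/
structure IsHolder {d : ℕ} (α L : ℝ) (f : (Fin d → ℝ) → ℝ) : Prop where
  contDiffOn : ContDiffOn ℝ (holderOrder α : ℕ) f (cube d)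
  deriv_sub_le : ∀ s : Fin d → ℕ, ∑ i, s i = holderOrder α →
    ∀ x ∈ cube d, ∀ y ∈ cube d,
      partialDeriv s f x - partialDeriv s f y ≤ L * ‖x - y‖ ^ (α - (holderOrder α : ℝ))
  taylor_le : ∀ x ∈ cube d, ∀ y ∈ cube d,
    |f x - taylorPoly (holderOrder α) f y x| ≤ L * ‖x - y‖ ^ α

/-! ### Feature map -/

/-- The degree of the local models: `⌊α⌋` (strict floor), but affine models are used for all
`α ≤ 2`. -/
def modelDegree (α : ℝ) : ℕ := max 1 (holderOrder α)

/-- The dimension `d'` of the local model: the number of multi-indices `s` with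
`1 ≤ |s| ≤ modelDegree α`. It is `d` for `α ≤ 2`. -/
def linDim (d : ℕ) (α : ℝ) : ℕ :=
  ((multiIndices d (modelDegree α)).filter fun s => 1 ≤ ∑ i, s i).card

/-- Coordinates of the feature vector: all monomials of degree at most `modelDegree α`. The
constant monomial carries the intercept `θ₀`. -/
abbrev FeatureIdx (d : ℕ) (α : ℝ) : Type := ↥(multiIndices d (modelDegree α))

/-- The feature map `φ`. -/
def feature (d : ℕ) (α : ℝ) (x : Fin d → ℝ) : FeatureIdx d α → ℝ := fun s => monomial s.1 x

/-! ### Bins and the algorithm -/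

/-- The `n = N^d` closed sub-cubes of side `1/N` into which `[0,1]^d` is divided. -/
def bin {d N : ℕ} (k : Fin (N ^ d)) : Set (Fin d → ℝ) :=
  {x | ∀ i, ((finFunctionFinEquiv.symm k i : ℕ) : ℝ) / N ≤ x i ∧
    x i ≤ (((finFunctionFinEquiv.symm k i : ℕ) : ℝ) + 1) / N}

/-- The misspecification error `ε = L n^{-α/d}`, with `n = N^d`. -/
def misspec (d N : ℕ) (α L : ℝ) : ℝ := L * ((N ^ d : ℕ) : ℝ) ^ (-(α / (d : ℝ)))

/-- A transcript: `act q`, `sel q` and `obs q` are the action, the bin and the observed reward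
of the `q`-th query (`q = 0, 1, …`). -/
structure Transcript (d N : ℕ) where
  act : ℕ → Fin d → ℝ
  sel : ℕ → Fin (N ^ d)
  obs : ℕ → ℝ

namespace Transcript

variable {d N : ℕ} (h : Transcript d N)

/-- The queries before `q` that went to the bin `k`. -/
def past (q : ℕ) (k : Fin (N ^ d)) : Finset ℕ := (Finset.range q).filter fun j => h.sel j = k

/-- The matrix `A = I + ∑ φ(x_j) φ(x_j)ᵀ` of the bin `k` before query `q`. -/
def design (α : ℝ) (q : ℕ) (k : Fin (N ^ d)) : Matrix (FeatureIdx d α) (FeatureIdx d α) ℝ :=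
  1 + ∑ j ∈ h.past q k, Matrix.vecMulVec (feature d α (h.act j)) (feature d α (h.act j))

/-- The estimate `θ̂ = A⁻¹ ∑ y_j φ(x_j)` of the bin `k` before query `q`. -/
def estimate (α : ℝ) (q : ℕ) (k : Fin (N ^ d)) : FeatureIdx d α → ℝ :=
  (h.design α q k)⁻¹ *ᵥ ∑ j ∈ h.past q k, h.obs j • feature d α (h.act j)

/-- The radius `β_{t+1} = 128 σ² d' ln(1+t) ln(4(t+1)²/(δ/n))` of a bin queried `t` times. -/
def radius (d N : ℕ) (α σ δ : ℝ) (t : ℕ) : ℝ :=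
  128 * σ ^ 2 * (linDim d α : ℝ) * Real.log (1 + (t : ℝ)) *
    Real.log (4 * ((t : ℝ) + 1) ^ 2 / (δ / ((N ^ d : ℕ) : ℝ)))

/-- The upper confidence bound of the bin `k` before query `q`, at the point `x`:
`⟨φ(x), θ̂⟩ + √β ‖A^{-1/2} φ(x)‖ + ε ∑_j |φ(x)ᵀ A⁻¹ φ(x_j)|`. -/
def ucb (α L σ δ : ℝ) (q : ℕ) (k : Fin (N ^ d)) (x : Fin d → ℝ) : ℝ :=
  feature d α x ⬝ᵥ h.estimate α q k
    + Real.sqrt (radius d N α σ δ (h.past q k).card)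
        * Real.sqrt (feature d α x ⬝ᵥ ((h.design α q k)⁻¹ *ᵥ feature d α x))
    + misspec d N α L *
        ∑ j ∈ h.past q k, |feature d α x ⬝ᵥ ((h.design α q k)⁻¹ *ᵥ feature d α (h.act j))|

/-- The transcript follows the rules of UCB-Meta with `n = N^d` bins over `n + T` queries: the
first `n` queries visit each bin once, at an arbitrary point of it. Each of the `T` later rounds
queries a bin whose local recommendation (a maximizer of its upper confidence bound over the bin)
has the largest upper confidence bound among all bins, at that recommendation. -/
structure FollowsUCBMeta (α L σ δ : ℝ) (T : ℕ) : Prop where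
  act_mem : ∀ q < N ^ d + T, h.act q ∈ bin (h.sel q)
  sel_init : ∀ q (hq : q < N ^ d), h.sel q = ⟨q, hq⟩
  act_max : ∀ q, N ^ d ≤ q → q < N ^ d + T →
    ∀ x ∈ bin (h.sel q), h.ucb α L σ δ q (h.sel q) x ≤ h.ucb α L σ δ q (h.sel q) (h.act q)
  sel_max : ∀ q, N ^ d ≤ q → q < N ^ d + T →
    ∀ k, ∀ x ∈ bin k, h.ucb α L σ δ q k x ≤ h.ucb α L σ δ q (h.sel q) (h.act q)

end Transcript

/-! ### Noise and runs -/

/-- The noise is i.i.d., centred and sub-Gaussian with parameter `σ`, where `ℱ q` is the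
information available before the `q`-th observation (past noise and internal randomness of the
algorithm): `η q` is independent of `ℱ q` and is revealed afterwards. In particular the `η q`
are mutually independent. -/
structure IsNoise {Ω : Type*} [mΩ : MeasurableSpace Ω] (μ : Measure Ω) (ℱ : Filtration ℕ mΩ)
    (σ : ℝ≥0) (η : ℕ → Ω → ℝ) : Prop where
  measurable : ∀ q, Measurable[ℱ (q + 1)] (η q)
  indep : ∀ q, Indep (ℱ q) (MeasurableSpace.comap (η q) inferInstance) μ
  identDistrib : ∀ q, IdentDistrib (η q) (η 0) μ μ
  mean_zero : ∀ q, ∫ ω, η q ω ∂μ = 0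
  subgaussian : ∀ q, HasSubgaussianMGF (η q) (σ ^ 2) μ

/-- The transcript for the outcome `ω`, with observations `y = f(x) + η`. -/
def transcript {Ω : Type*} {d N : ℕ} (f : (Fin d → ℝ) → ℝ) (η : ℕ → Ω → ℝ)
    (X : ℕ → Ω → Fin d → ℝ) (K : ℕ → Ω → Fin (N ^ d)) (ω : Ω) : Transcript d N where
  act q := X q ω
  sel q := K q ω
  obs q := f (X q ω) + η q ω

/-- A run of UCB-Meta on the reward function `f`: actions `X` and bins `K` that depend only on
the information available before each query and follow the rules of the algorithm. -/
structure IsRun {Ω : Type*} [mΩ : MeasurableSpace Ω] (ℱ : Filtration ℕ mΩ) {d N : ℕ}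
    (α L σ δ : ℝ) (T : ℕ) (f : (Fin d → ℝ) → ℝ) (η : ℕ → Ω → ℝ)
    (X : ℕ → Ω → Fin d → ℝ) (K : ℕ → Ω → Fin (N ^ d)) : Prop where
  measurable_act : ∀ q, Measurable[ℱ q] (X q)
  measurable_sel : ∀ q, Measurable[ℱ q] (K q)
  follows : ∀ ω, (transcript f η X K ω).FollowsUCBMeta α L σ δ T

/-- Cumulative pseudo-regret of the `T` queries that start at query number `a`. -/
def regret {d : ℕ} (f : (Fin d → ℝ) → ℝ) (xstar : Fin d → ℝ) (x : ℕ → Fin d → ℝ)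
    (a T : ℕ) : ℝ :=
  ∑ τ ∈ Finset.range T, (f xstar - f (x (a + τ)))

end HolderBandit

end

noncomputable section

namespace HolderBandit

/-! ### A one-dimensional Gaussian mixture bound -/

/-! On a bin of side `1/N` the Taylor polynomial of `f` is a linear function of the monomial
features and approximates `f` up to `ε`. Each bin is therefore a linear bandit with misspecification
`ε`, and the algorithm is optimism over all bins at once.

Confidence. With `S` the noise sum and `A` the regularized Gram matrix of a bin, `exp (SᵀA⁻¹S /
(2σ²)) / √(det A)` is a supermartingale (`setLIntegral_expProcess_succ_le`): its one-step factor is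
a Gaussian mixture of exponentials linear in the noise. Ville's inequality at level `δ/n` and a
union bound over the bins control `SᵀA⁻¹S` for all bins and times (`measure_noise_event_ge`).

Regret. On that event optimism bounds the regret of a round by `2ε` plus twice the confidence width
at the query (`round_regret_le`). The elliptical potential bounds the squared clipped widths of one
bin by a multiple of `d' ln T`. Cauchy–Schwarz turns this into `√(Tn)` for the noise part and, bin
by bin, into `T` for the misspecification part (`sum_round_widths_le`).

Regularization bias. The radius must also dominate the squared norm of the local parameter. This
norm is at most `d'κ` with `κ` depending only on `α` and `L`, because polynomial coefficients are
controlled by the supremum on the cube with a dimension-free constant (`exists_coeff_bound`). The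
radius suffices once `κ ≤ 16σ² ln n`. With fewer bins `ε` is bounded below by a constant, and the
term `d' ε T √(ln T)` already exceeds the trivial bound on the regret.

Part (2) balances the two terms of part (1) and absorbs the cost `2n` of the initial queries. -/

/-- Completing the square turns the integrand into a multiple of another Gaussian density, which has
mass one. Both integrals below are computed this way. -/
lemma lintegral_stdGaussian_of_mul_pdf {f : ℝ → ℝ} (hf : Measurable f)
    {c m : ℝ} {v : ℝ≥0} (hv : v ≠ 0) (hc : 0 ≤ c)
    (h : ∀ s, gaussianPDFReal 0 1 s * f s = c * gaussianPDFReal m v s) :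
    ∫⁻ s, ENNReal.ofReal (f s) ∂(gaussianReal 0 1) = ENNReal.ofReal c := by
  rw [gaussianReal_of_var_ne_zero 0 one_ne_zero,
    lintegral_withDensity_eq_lintegral_mul _ (measurable_gaussianPDF 0 1) hf.ennreal_ofReal]
  have : ∀ s, (gaussianPDF 0 1 * fun s => ENNReal.ofReal (f s)) s
      = ENNReal.ofReal c * ENNReal.ofReal (gaussianPDFReal m v s) := by
    intro s
    rw [Pi.mul_apply, gaussianPDF, ← ENNReal.ofReal_mul (gaussianPDFReal_nonneg 0 1 s), h,
      ENNReal.ofReal_mul hc]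
  simp_rw [this]
  rw [lintegral_const_mul _ (measurable_gaussianPDFReal m v).ennreal_ofReal,
    lintegral_gaussianPDFReal_eq_one m hv, mul_one]

lemma lintegral_exp_mul_stdGaussian (x : ℝ) :
    ∫⁻ s, ENNReal.ofReal (Real.exp (x * s)) ∂(gaussianReal 0 1)
      = ENNReal.ofReal (Real.exp (x ^ 2 / 2)) := by
  refine lintegral_stdGaussian_of_mul_pdf (by fun_prop)
    (m := x) (v := 1) one_ne_zero (Real.exp_pos _).le fun s => ?_
  simp only [gaussianPDFReal, NNReal.coe_one]
  rw [mul_assoc, ← Real.exp_add, mul_left_comm, ← Real.exp_add]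
  congr 2
  ring

/-- Since `k² < 1` the Gaussian weight still wins; the new variance is `1 / (1 - k²) = 1 + w`. -/
lemma lintegral_exp_sq_stdGaussian (a k w : ℝ) (hw : 0 ≤ w) (hk : k ^ 2 = w / (1 + w)) :
    ∫⁻ s, ENNReal.ofReal (Real.exp ((a + k * s) ^ 2 / 2)) ∂(gaussianReal 0 1)
      = ENNReal.ofReal (√(1 + w) * Real.exp (a ^ 2 * (1 + w) / 2)) := by
  have hw1 : (0 : ℝ) < 1 + w := by linarith
  obtain ⟨v, hv⟩ : ∃ v : ℝ≥0, (v : ℝ) = 1 + w := ⟨⟨1 + w, hw1.le⟩, rfl⟩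
  refine lintegral_stdGaussian_of_mul_pdf (by fun_prop)
    (m := a * k * (1 + w)) (v := v) (fun h => hw1.ne' (by rw [← hv, h, NNReal.coe_zero]))
    (by positivity) fun s => ?_
  simp only [gaussianPDFReal, NNReal.coe_one, hv]
  rw [Real.sqrt_mul (by positivity) (1 + w), mul_one, mul_assoc, ← Real.exp_add]
  have h2 : √(1 + w) ≠ 0 := (Real.sqrt_pos.2 hw1).ne'
  have h3 : √(2 * Real.pi) ≠ 0 := (Real.sqrt_pos.2 (by positivity)).ne'
  have h4 : √(1 + w) * Real.exp (a ^ 2 * (1 + w) / 2) *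
      ((√(2 * Real.pi) * √(1 + w))⁻¹ * Real.exp (-(s - a * k * (1 + w)) ^ 2 / (2 * (1 + w))))
      = (√(2 * Real.pi))⁻¹ * (Real.exp (a ^ 2 * (1 + w) / 2) *
        Real.exp (-(s - a * k * (1 + w)) ^ 2 / (2 * (1 + w)))) := by
    field_simp
  rw [h4, ← Real.exp_add]
  congr 2
  have e : -(s - a * k * (1 + w)) ^ 2 / (2 * (1 + w))
      = -s ^ 2 / (2 * (1 + w)) + s * a * k - a ^ 2 * k ^ 2 * (1 + w) / 2 := by
    field_simp
    ring
  have e2 : (a + k * s) ^ 2 = a ^ 2 + 2 * a * k * s + k ^ 2 * s ^ 2 := by ring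
  rw [e, e2, hk]
  field_simp
  ring

/-- The mixture bound behind the self-normalized supermartingale: it controls one rank-one update
of the Gram matrix, where `w = φᵀ A⁻¹ φ` and `u = φᵀ A⁻¹ S`. -/
lemma lintegral_exp_update_le (ν : Measure ℝ) [SFinite ν] {σ : ℝ} (hσ : 0 < σ)
    (hν : ∀ t, ∫⁻ y, ENNReal.ofReal (Real.exp (t * y)) ∂ν
      ≤ ENNReal.ofReal (Real.exp (σ ^ 2 * t ^ 2 / 2))) {w : ℝ} (hw : 0 ≤ w) (u : ℝ) :
    ∫⁻ y, ENNReal.ofReal (Real.exp ((2 * y * u + y ^ 2 * w - u ^ 2) / (2 * σ ^ 2 * (1 + w)))) ∂ν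
      ≤ ENNReal.ofReal (√(1 + w)) := by
  have hw1 : (0 : ℝ) < 1 + w := by linarith
  -- The exponent is quadratic in `y`. With these `k`, `a`, `b` it becomes a standard Gaussian
  -- average over `s` of exponentials linear in `y`, to which the sub-Gaussian bound applies after
  -- exchanging the integrals.
  set k := √(w / (1 + w)) with hk
  have hk2 : k ^ 2 = w / (1 + w) := Real.sq_sqrt (by positivity)
  set a := u / (σ ^ 2 * (1 + w)) with ha
  set b := Real.exp (-(u ^ 2 / (2 * σ ^ 2 * (1 + w)))) with hb
  have hb0 : 0 ≤ b := (Real.exp_pos _).le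
  have key : ∀ y : ℝ,
      ENNReal.ofReal (Real.exp ((2 * y * u + y ^ 2 * w - u ^ 2) / (2 * σ ^ 2 * (1 + w))))
      = ∫⁻ s, ENNReal.ofReal b * ENNReal.ofReal (Real.exp ((a + k / σ * s) * y))
          ∂(gaussianReal 0 1) := by
    intro y
    have h1 : ∀ s : ℝ, ENNReal.ofReal b * ENNReal.ofReal (Real.exp ((a + k / σ * s) * y))
        = ENNReal.ofReal (b * Real.exp (a * y)) * ENNReal.ofReal (Real.exp (k / σ * y * s)) := by
      intro s
      rw [← ENNReal.ofReal_mul hb0, ← ENNReal.ofReal_mul (by positivity), mul_assoc b,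
        ← Real.exp_add (a * y)]
      congr 3
      ring
    simp_rw [h1]
    rw [lintegral_const_mul _ (by fun_prop), lintegral_exp_mul_stdGaussian,
      ← ENNReal.ofReal_mul (by positivity), hb, ← Real.exp_add, ← Real.exp_add]
    congr 2
    rw [mul_pow, div_pow, hk2, ha]
    field_simp
    ring
  simp_rw [key]
  rw [lintegral_lintegral_swap (by fun_prop)]
  calc ∫⁻ s, ∫⁻ y, ENNReal.ofReal b * ENNReal.ofReal (Real.exp ((a + k / σ * s) * y)) ∂ν
        ∂(gaussianReal 0 1)
      ≤ ∫⁻ s, ENNReal.ofReal b * ENNReal.ofReal (Real.exp ((σ * a + k * s) ^ 2 / 2))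
          ∂(gaussianReal 0 1) := by
        refine lintegral_mono fun s => ?_
        rw [lintegral_const_mul _ (by fun_prop)]
        gcongr
        refine (hν _).trans (le_of_eq ?_)
        congr 3
        field_simp
    _ = ENNReal.ofReal (√(1 + w)) := by
        rw [lintegral_const_mul _ (by fun_prop), lintegral_exp_sq_stdGaussian _ _ _ hw hk2,
          ← ENNReal.ofReal_mul hb0, mul_left_comm, hb, ← Real.exp_add]
        have : -(u ^ 2 / (2 * σ ^ 2 * (1 + w))) + (σ * a) ^ 2 * (1 + w) / 2 = 0 := by
          rw [ha]
          field_simp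
          ring
        rw [this, Real.exp_zero, mul_one]

/-! ### Regularized Gram matrices -/

section Gram

variable {ι : Type*} [Fintype ι] [DecidableEq ι]

lemma dotProduct_inv_comm {A : Matrix ι ι ℝ} (hA : A.PosDef) (x y : ι → ℝ) :
    x ⬝ᵥ (A⁻¹ *ᵥ y) = y ⬝ᵥ (A⁻¹ *ᵥ x) := by
  have h : (A⁻¹)ᵀ = A⁻¹ := by
    have := hA.inv.isHermitian
    rwa [Matrix.IsHermitian, Matrix.conjTranspose_eq_transpose_of_trivial] at this
  rw [Matrix.dotProduct_mulVec, ← Matrix.mulVec_transpose, h, dotProduct_comm]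

lemma dotProduct_inv_nonneg {A : Matrix ι ι ℝ} (hA : A.PosDef) (x : ι → ℝ) :
    0 ≤ x ⬝ᵥ (A⁻¹ *ᵥ x) := by
  simpa using hA.inv.posSemidef.dotProduct_mulVec_nonneg x

/-- Cauchy–Schwarz for the inner product of `A⁻¹`, read off the discriminant of the quadratic form
along `x + s • y`. -/
lemma abs_dotProduct_inv_le {A : Matrix ι ι ℝ} (hA : A.PosDef) (x y : ι → ℝ) :
    |x ⬝ᵥ (A⁻¹ *ᵥ y)| ≤ √(x ⬝ᵥ (A⁻¹ *ᵥ x)) * √(y ⬝ᵥ (A⁻¹ *ᵥ y)) := by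
  rw [← Real.sqrt_mul (dotProduct_inv_nonneg hA x)]
  refine Real.abs_le_sqrt ?_
  have h : ∀ s : ℝ, 0 ≤ (y ⬝ᵥ (A⁻¹ *ᵥ y)) * (s * s) + (2 * (x ⬝ᵥ (A⁻¹ *ᵥ y))) * s
      + x ⬝ᵥ (A⁻¹ *ᵥ x) := by
    intro s
    have := dotProduct_inv_nonneg hA (x + s • y)
    simp only [Matrix.mulVec_add, Matrix.mulVec_smul, add_dotProduct, dotProduct_add,
      smul_dotProduct, dotProduct_smul, smul_eq_mul] at this
    rw [dotProduct_inv_comm hA y x] at this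
    linarith
  have := discrim_le_zero h
  rw [discrim] at this
  nlinarith

lemma inv_mulVec_eq {A : Matrix ι ι ℝ} (hA : A.PosDef) {x y : ι → ℝ} (h : A *ᵥ x = y) :
    A⁻¹ *ᵥ y = x := by
  rw [← h, Matrix.mulVec_mulVec, Matrix.nonsing_inv_mul _ ((Matrix.isUnit_iff_isUnit_det _).1
    hA.isUnit), Matrix.one_mulVec]

lemma mulVec_inv_mulVec {A : Matrix ι ι ℝ} (hA : A.PosDef) (x : ι → ℝ) :
    A *ᵥ (A⁻¹ *ᵥ x) = x := by
  rw [Matrix.mulVec_mulVec, Matrix.mul_nonsing_inv _ ((Matrix.isUnit_iff_isUnit_det _).1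
    hA.isUnit), Matrix.one_mulVec]

omit [DecidableEq ι] in
lemma vecMulVec_mulVec_self (p x : ι → ℝ) :
    Matrix.vecMulVec p p *ᵥ x = (p ⬝ᵥ x) • p := by
  rw [Matrix.vecMulVec_mulVec]
  ext i
  simp [mul_comm]

omit [DecidableEq ι] in
lemma posDef_add_vecMulVec {A : Matrix ι ι ℝ} (hA : A.PosDef) (p : ι → ℝ) :
    (A + Matrix.vecMulVec p p).PosDef :=
  hA.add_posSemidef (by simpa using Matrix.posSemidef_vecMulVec_self_star p)

lemma selfNorm_update {A : Matrix ι ι ℝ} (hA : A.PosDef) (p S : ι → ℝ) (y : ℝ) :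
    (S + y • p) ⬝ᵥ ((A + Matrix.vecMulVec p p)⁻¹ *ᵥ (S + y • p))
      = S ⬝ᵥ (A⁻¹ *ᵥ S) + (2 * y * (p ⬝ᵥ (A⁻¹ *ᵥ S)) + y ^ 2 * (p ⬝ᵥ (A⁻¹ *ᵥ p))
        - (p ⬝ᵥ (A⁻¹ *ᵥ S)) ^ 2) / (1 + p ⬝ᵥ (A⁻¹ *ᵥ p)) := by
  have hw := dotProduct_inv_nonneg hA p
  set w := p ⬝ᵥ (A⁻¹ *ᵥ p) with hwdef
  set u := p ⬝ᵥ (A⁻¹ *ᵥ S) with hu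
  have hw1 : 1 + w ≠ 0 := by positivity
  -- `c` is the inner product of `p` with the updated solution: it solves `u + (y - c) * w = c`.
  set c := (u + y * w) / (1 + w) with hc
  have hsol : (A + Matrix.vecMulVec p p)⁻¹ *ᵥ (S + y • p)
      = A⁻¹ *ᵥ S + (y - c) • (A⁻¹ *ᵥ p) := by
    refine inv_mulVec_eq (posDef_add_vecMulVec hA p) ?_
    rw [Matrix.add_mulVec, vecMulVec_mulVec_self, Matrix.mulVec_add, Matrix.mulVec_smul,
      mulVec_inv_mulVec hA, mulVec_inv_mulVec hA, dotProduct_add, dotProduct_smul, ← hu, ← hwdef,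
      add_assoc, ← add_smul]
    congr 2
    rw [hc, smul_eq_mul]
    field_simp
    ring
  rw [hsol]
  simp only [add_dotProduct, dotProduct_add, smul_dotProduct, dotProduct_smul, smul_eq_mul]
  rw [dotProduct_inv_comm hA S p, ← hu, ← hwdef, hc]
  field_simp
  ring

lemma det_add_vecMulVec_self {A : Matrix ι ι ℝ} (hA : A.PosDef) (p : ι → ℝ) :
    (A + Matrix.vecMulVec p p).det = A.det * (1 + p ⬝ᵥ (A⁻¹ *ᵥ p)) := by
  rw [Matrix.vecMulVec_eq Unit, Matrix.det_add_replicateCol_mul_replicateRow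
    ((Matrix.isUnit_iff_isUnit_det _).1 hA.isUnit), Matrix.dotProduct_mulVec,
    ← Matrix.replicateRow_vecMul]
  simp [Matrix.det_unique, Matrix.mul_apply, dotProduct, Matrix.replicateRow, Matrix.replicateCol]

/-- AM–GM for the eigenvalues in logarithmic form, by summing `log (lam / c) ≤ lam / c - 1` over the
eigenvalues `lam`. -/
lemma log_det_le_of_trace_le {A : Matrix ι ι ℝ} (hA : A.PosDef) {c : ℝ} (hc : 0 < c)
    (h : A.trace ≤ Fintype.card ι * c) : Real.log A.det ≤ Fintype.card ι * Real.log c := by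
  have hH := hA.isHermitian
  have hpos := hA.eigenvalues_pos
  have hdet : A.det = ∏ i, hH.eigenvalues i := by simpa using hH.det_eq_prod_eigenvalues
  have htr : A.trace = ∑ i, hH.eigenvalues i := by simpa using hH.trace_eq_sum_eigenvalues
  rw [hdet, Real.log_prod fun i _ => (hpos i).ne']
  calc ∑ i, Real.log (hH.eigenvalues i)
      ≤ ∑ i, (hH.eigenvalues i / c - 1 + Real.log c) := by
        refine Finset.sum_le_sum fun i _ => ?_
        have := Real.log_le_sub_one_of_pos (div_pos (hpos i) hc)
        rw [Real.log_div (hpos i).ne' hc.ne'] at this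
        linarith
    _ = A.trace / c - Fintype.card ι + Fintype.card ι * Real.log c := by
        rw [htr, Finset.sum_add_distrib, Finset.sum_sub_distrib, Finset.sum_div]
        simp
    _ ≤ Fintype.card ι * Real.log c := by
        have : A.trace / c ≤ Fintype.card ι := by rwa [div_le_iff₀ hc]
        linarith

/-! ### Gram matrices of a sequence and the elliptical potential -/

/-- The regularized Gram matrix of the first `q` vectors. -/
def gram (ψ : ℕ → ι → ℝ) (q : ℕ) : Matrix ι ι ℝ :=
  1 + ∑ j ∈ Finset.range q, Matrix.vecMulVec (ψ j) (ψ j)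

omit [Fintype ι] in
lemma gram_zero (ψ : ℕ → ι → ℝ) : gram ψ 0 = 1 := by simp [gram]

omit [Fintype ι] in
lemma gram_succ (ψ : ℕ → ι → ℝ) (q : ℕ) :
    gram ψ (q + 1) = gram ψ q + Matrix.vecMulVec (ψ q) (ψ q) := by
  rw [gram, gram, Finset.sum_range_succ, add_assoc]

lemma posDef_gram (ψ : ℕ → ι → ℝ) (q : ℕ) : (gram ψ q).PosDef := by
  induction q with
  | zero => rw [gram_zero]; exact Matrix.PosDef.one
  | succ q ih => rw [gram_succ]; exact posDef_add_vecMulVec ih _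

/-- The squared norm of `ψ q` in the geometry of the first `q` vectors. -/
def width (ψ : ℕ → ι → ℝ) (q : ℕ) : ℝ := ψ q ⬝ᵥ ((gram ψ q)⁻¹ *ᵥ ψ q)

lemma width_nonneg (ψ : ℕ → ι → ℝ) (q : ℕ) : 0 ≤ width ψ q :=
  dotProduct_inv_nonneg (posDef_gram ψ q) _

lemma det_gram_pos (ψ : ℕ → ι → ℝ) (q : ℕ) : 0 < (gram ψ q).det := (posDef_gram ψ q).det_pos

lemma det_gram_succ (ψ : ℕ → ι → ℝ) (q : ℕ) :
    (gram ψ (q + 1)).det = (gram ψ q).det * (1 + width ψ q) := by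
  rw [gram_succ, det_add_vecMulVec_self (posDef_gram ψ q), width]

lemma gram_mulVec (ψ : ℕ → ι → ℝ) (q : ℕ) (x : ι → ℝ) :
    gram ψ q *ᵥ x = x + ∑ j ∈ Finset.range q, (ψ j ⬝ᵥ x) • ψ j := by
  simp_rw [gram, Matrix.add_mulVec, Matrix.one_mulVec, Matrix.sum_mulVec, vecMulVec_mulVec_self]

/-- Put `z = A⁻¹x`, expand `x = Az = z + ∑ (ψ_j · z) ψ_j` and pair with `z`. Dropping one
nonnegative summand or the other gives the two inequalities that follow. -/
lemma dotProduct_gram_inv_self (ψ : ℕ → ι → ℝ) (q : ℕ) (x : ι → ℝ) :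
    x ⬝ᵥ ((gram ψ q)⁻¹ *ᵥ x) = ((gram ψ q)⁻¹ *ᵥ x) ⬝ᵥ ((gram ψ q)⁻¹ *ᵥ x)
      + ∑ j ∈ Finset.range q, (x ⬝ᵥ ((gram ψ q)⁻¹ *ᵥ ψ j)) ^ 2 := by
  have hA := posDef_gram ψ q
  have hx := mulVec_inv_mulVec hA x
  simp_rw [dotProduct_inv_comm hA x (ψ _)]
  set z := (gram ψ q)⁻¹ *ᵥ x
  rw [gram_mulVec] at hx
  conv_lhs => rw [← hx]
  rw [add_dotProduct, sum_dotProduct]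
  simp only [smul_dotProduct, smul_eq_mul, sq]

lemma sum_sq_dotProduct_gram_inv_le (ψ : ℕ → ι → ℝ) (q : ℕ) (x : ι → ℝ) :
    ∑ j ∈ Finset.range q, (x ⬝ᵥ ((gram ψ q)⁻¹ *ᵥ ψ j)) ^ 2 ≤ x ⬝ᵥ ((gram ψ q)⁻¹ *ᵥ x) := by
  rw [dotProduct_gram_inv_self]
  have := dotProduct_self_star_nonneg ((gram ψ q)⁻¹ *ᵥ x)
  simp only [star_trivial] at this
  linarith

lemma dotProduct_gram_inv_le (ψ : ℕ → ι → ℝ) (q : ℕ) (x : ι → ℝ) :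
    x ⬝ᵥ ((gram ψ q)⁻¹ *ᵥ x) ≤ x ⬝ᵥ x := by
  have h := dotProduct_gram_inv_self ψ q x
  have h2 := dotProduct_self_star_nonneg (x - (gram ψ q)⁻¹ *ᵥ x)
  have h3 : 0 ≤ ∑ j ∈ Finset.range q, (x ⬝ᵥ ((gram ψ q)⁻¹ *ᵥ ψ j)) ^ 2 :=
    Finset.sum_nonneg fun _ _ => sq_nonneg _
  simp only [star_trivial, sub_dotProduct, dotProduct_sub] at h2
  rw [dotProduct_comm ((gram ψ q)⁻¹ *ᵥ x) x] at h2
  linarith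

lemma sum_log_width (ψ : ℕ → ι → ℝ) (q : ℕ) :
    ∑ j ∈ Finset.range q, Real.log (1 + width ψ j) = Real.log (gram ψ q).det := by
  induction q with
  | zero => simp [gram_zero]
  | succ q ih =>
    have := width_nonneg ψ q
    rw [Finset.sum_range_succ, ih, det_gram_succ, Real.log_mul (det_gram_pos ψ q).ne'
      (by positivity)]

lemma min_one_le_two_mul_log {w : ℝ} (hw : 0 ≤ w) : min 1 w ≤ 2 * Real.log (1 + w) := by
  have h1 := Real.one_sub_inv_le_log_of_pos (show 0 < 1 + w by linarith)
  have h2 : 1 - (1 + w)⁻¹ = w / (1 + w) := by field_simp; ring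
  have h3 : min 1 w ≤ 2 * (w / (1 + w)) := by
    rw [← mul_div_assoc, le_div_iff₀ (by linarith)]
    rcases le_total 1 w with h | h
    · rw [min_eq_left h]; linarith
    · rw [min_eq_right h]; nlinarith
  linarith

/-- The elliptical potential bound. -/
lemma sum_min_width_le (ψ : ℕ → ι → ℝ) (q : ℕ) :
    ∑ j ∈ Finset.range q, min 1 (width ψ j) ≤ 2 * Real.log (gram ψ q).det := by
  rw [← sum_log_width, Finset.mul_sum]
  exact Finset.sum_le_sum fun j _ => min_one_le_two_mul_log (width_nonneg ψ j)

lemma trace_gram (ψ : ℕ → ι → ℝ) (q : ℕ) :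
    (gram ψ q).trace = Fintype.card ι + ∑ j ∈ Finset.range q, ψ j ⬝ᵥ ψ j := by
  simp [gram, Matrix.trace_add, Matrix.trace_sum, Matrix.trace_vecMulVec]

end Gram

/-! ### The self-normalized supermartingale -/

section Ville

/-- Ville's maximal inequality over a finite horizon. -/
lemma ville_finite {Ω : Type*} [mΩ : MeasurableSpace Ω] (μ : Measure Ω) (ℱ : Filtration ℕ mΩ)
    (M : ℕ → Ω → ℝ≥0∞) (hM : ∀ q, Measurable[ℱ q] (M q))
    (hstep : ∀ q B, MeasurableSet[ℱ q] B → ∫⁻ ω in B, M (q + 1) ω ∂μ ≤ ∫⁻ ω in B, M q ω ∂μ)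
    (c : ℝ≥0∞) (Q : ℕ) :
    c * μ {ω | ∃ q < Q, c ≤ M q ω} ≤ ∫⁻ ω, M 0 ω ∂μ := by
  have hbad : ∀ q, MeasurableSet[ℱ q] {ω | c ≤ M q ω} := fun q => hM q measurableSet_Ici
  have hgood : ∀ Q, MeasurableSet[ℱ Q] {ω | ∀ q < Q, M q ω < c} := by
    intro Q
    have : {ω | ∀ q < Q, M q ω < c} = ⋂ q ∈ Finset.range Q, {ω | c ≤ M q ω}ᶜ := by
      ext ω; simp
    rw [this]
    refine Finset.measurableSet_biInter _ fun q hq => ?_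
    exact ℱ.mono (Finset.mem_range.1 hq).le _ (hbad q).compl
  -- This is the process stopped when it first reaches `c`: paths that have crossed count `c`, the
  -- others carry their current value.
  have main : ∀ Q, c * μ {ω | ∃ q < Q, c ≤ M q ω} + ∫⁻ ω in {ω | ∀ q < Q, M q ω < c}, M Q ω ∂μ
      ≤ ∫⁻ ω, M 0 ω ∂μ := by
    intro Q
    induction Q with
    | zero => simp
    | succ Q ih =>
      refine le_trans ?_ ih
      set G := {ω | ∀ q < Q, M q ω < c}
      set E := {ω | ∃ q < Q, c ≤ M q ω}
      set D := {ω | c ≤ M Q ω}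
      have hD : MeasurableSet D := ℱ.le _ _ (hbad Q)
      have h1 : {ω | ∃ q < Q + 1, c ≤ M q ω} ⊆ E ∪ (G ∩ D) := by
        rintro ω ⟨q, hq, hc⟩
        by_cases hE : ω ∈ E
        · exact Or.inl hE
        · have hG : ω ∈ G := by
            intro j hj
            by_contra hcon
            exact hE ⟨j, hj, not_lt.1 hcon⟩
          rcases Nat.lt_succ_iff_lt_or_eq.1 hq with h | rfl
          · exact absurd ⟨q, h, hc⟩ hE
          · exact Or.inr ⟨hG, hc⟩
      have h2 : {ω | ∀ q < Q + 1, M q ω < c} = G \ D := by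
        ext ω
        simp only [Set.mem_ofPred_eq, Set.mem_sdiff, not_le, G, D, Nat.lt_succ_iff_lt_or_eq]
        constructor
        · exact fun h => ⟨fun q hq => h q (Or.inl hq), h Q (Or.inr rfl)⟩
        · rintro ⟨ha, hb⟩ q (hq | rfl)
          exacts [ha q hq, hb]
      calc c * μ {ω | ∃ q < Q + 1, c ≤ M q ω}
            + ∫⁻ ω in {ω | ∀ q < Q + 1, M q ω < c}, M (Q + 1) ω ∂μ
          ≤ c * (μ E + μ (G ∩ D)) + ∫⁻ ω in G \ D, M Q ω ∂μ := by
            refine add_le_add ?_ ?_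
            · gcongr
              exact (measure_mono h1).trans (measure_union_le _ _)
            · rw [h2]
              exact hstep Q _ ((hgood Q).diff (hbad Q))
        _ ≤ c * μ E + (∫⁻ ω in G ∩ D, M Q ω ∂μ + ∫⁻ ω in G \ D, M Q ω ∂μ) := by
            rw [mul_add, add_assoc]
            gcongr
            rw [← setLIntegral_const]
            exact setLIntegral_mono_ae ((hM Q).mono (ℱ.le Q) le_rfl).aemeasurable
              (Filter.Eventually.of_forall fun ω hω => hω.2)
        _ = c * μ E + ∫⁻ ω in G, M Q ω ∂μ := by rw [lintegral_inter_add_sdiff _ _ hD]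
  exact le_trans (le_add_right le_rfl) (main Q)

end Ville

/-! ### Measurability and the exponential supermartingale -/

section Martingale

variable {ι : Type*} [Fintype ι] [DecidableEq ι]

lemma measurable_matrix_det {Ω : Type*} [mΩ : MeasurableSpace Ω] {A : Ω → Matrix ι ι ℝ}
    (hA : ∀ i j, Measurable fun ω => A ω i j) : Measurable fun ω => (A ω).det := by
  simp_rw [Matrix.det_apply]
  exact Finset.measurable_sum _ fun τ _ =>
    (Finset.measurable_prod _ fun i _ => hA _ _).const_smul (Equiv.Perm.sign τ)

lemma measurable_matrix_inv {Ω : Type*} [mΩ : MeasurableSpace Ω] {A : Ω → Matrix ι ι ℝ}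
    (hA : ∀ i j, Measurable fun ω => A ω i j) (i j : ι) : Measurable fun ω => (A ω)⁻¹ i j := by
  simp_rw [Matrix.inv_def, Matrix.smul_apply, Ring.inverse_eq_inv', smul_eq_mul,
    Matrix.adjugate_apply]
  refine (measurable_matrix_det hA).inv.mul (measurable_matrix_det fun a b => ?_)
  by_cases h : a = j
  · subst h
    simp
  · simp only [Matrix.updateRow_ne h]
    exact hA a b

lemma measurable_dotProduct_inv {Ω : Type*} [mΩ : MeasurableSpace Ω] {A : Ω → Matrix ι ι ℝ}
    {x y : Ω → ι → ℝ} (hA : ∀ i j, Measurable fun ω => A ω i j) (hx : Measurable x)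
    (hy : Measurable y) : Measurable fun ω => x ω ⬝ᵥ ((A ω)⁻¹ *ᵥ y ω) := by
  simp only [dotProduct, Matrix.mulVec]
  have hx' := fun i => (measurable_pi_apply i).comp hx
  have hy' := fun i => (measurable_pi_apply i).comp hy
  exact Finset.measurable_sum _ fun i _ => (hx' i).mul (Finset.measurable_sum _ fun j _ =>
    (measurable_matrix_inv hA i j).mul (hy' j))

omit [Fintype ι] in
lemma measurable_gram {Ω : Type*} [mΩ : MeasurableSpace Ω] {Ψ : ℕ → Ω → ι → ℝ} {q : ℕ}
    (hΨ : ∀ j < q, Measurable (Ψ j)) (a b : ι) :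
    Measurable fun ω => gram (fun j => Ψ j ω) q a b := by
  simp only [gram, Matrix.add_apply, Matrix.sum_apply, Matrix.vecMulVec_apply]
  refine measurable_const.add (Finset.measurable_sum _ fun j hj => ?_)
  have h := hΨ j (Finset.mem_range.1 hj)
  exact ((measurable_pi_apply a).comp h).mul ((measurable_pi_apply b).comp h)

/-- The noise vector `S = ∑ ξ_j ψ_j`. -/
def noiseSum (ψ : ℕ → ι → ℝ) (ξ : ℕ → ℝ) (q : ℕ) : ι → ℝ := ∑ j ∈ Finset.range q, ξ j • ψ j

/-- The self-normalized squared norm `Sᵀ A⁻¹ S`. -/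
def selfNorm (ψ : ℕ → ι → ℝ) (ξ : ℕ → ℝ) (q : ℕ) : ℝ :=
  noiseSum ψ ξ q ⬝ᵥ ((gram ψ q)⁻¹ *ᵥ noiseSum ψ ξ q)

/-- The exponential process `exp (SᵀA⁻¹S / (2σ²)) / √(det A)`. -/
def expProcess (σ : ℝ) (ψ : ℕ → ι → ℝ) (ξ : ℕ → ℝ) (q : ℕ) : ℝ :=
  Real.exp (selfNorm ψ ξ q / (2 * σ ^ 2)) / √((gram ψ q).det)

lemma expProcess_zero (σ : ℝ) (ψ : ℕ → ι → ℝ) (ξ : ℕ → ℝ) : expProcess σ ψ ξ 0 = 1 := by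
  simp [expProcess, selfNorm, noiseSum, gram_zero]

lemma expProcess_nonneg (σ : ℝ) (ψ : ℕ → ι → ℝ) (ξ : ℕ → ℝ) (q : ℕ) :
    0 ≤ expProcess σ ψ ξ q := by
  unfold expProcess; positivity

/-- The new factor depends on the past only through `u` and `w`; `lintegral_exp_update_le` says that
its average over the new noise is at most one. -/
lemma expProcess_succ {σ : ℝ} (ψ : ℕ → ι → ℝ) (ξ : ℕ → ℝ) (q : ℕ) :
    expProcess σ ψ ξ (q + 1) = expProcess σ ψ ξ q *
      (Real.exp ((2 * ξ q * (ψ q ⬝ᵥ ((gram ψ q)⁻¹ *ᵥ noiseSum ψ ξ q)) + ξ q ^ 2 * width ψ q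
        - (ψ q ⬝ᵥ ((gram ψ q)⁻¹ *ᵥ noiseSum ψ ξ q)) ^ 2) / (2 * σ ^ 2 * (1 + width ψ q)))
        / √(1 + width ψ q)) := by
  have hV : selfNorm ψ ξ (q + 1) = noiseSum ψ ξ q ⬝ᵥ ((gram ψ q)⁻¹ *ᵥ noiseSum ψ ξ q)
      + (2 * ξ q * (ψ q ⬝ᵥ ((gram ψ q)⁻¹ *ᵥ noiseSum ψ ξ q))
        + ξ q ^ 2 * (ψ q ⬝ᵥ ((gram ψ q)⁻¹ *ᵥ ψ q))
        - (ψ q ⬝ᵥ ((gram ψ q)⁻¹ *ᵥ noiseSum ψ ξ q)) ^ 2)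
        / (1 + ψ q ⬝ᵥ ((gram ψ q)⁻¹ *ᵥ ψ q)) := by
    rw [selfNorm, gram_succ, noiseSum, Finset.sum_range_succ, ← noiseSum,
      selfNorm_update (posDef_gram ψ q)]
  rw [expProcess, hV, det_gram_succ, Real.sqrt_mul (det_gram_pos ψ q).le, expProcess,
    div_mul_div_comm, ← Real.exp_add, ← selfNorm, ← width]
  congr 2
  rw [add_div, div_div, mul_comm (1 + width ψ q)]

omit [DecidableEq ι] in
lemma measurable_noiseSum {Ω : Type*} [mΩ : MeasurableSpace Ω] {Ψ : ℕ → Ω → ι → ℝ} {η : ℕ → Ω → ℝ}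
    {q : ℕ} (hΨ : ∀ j < q, Measurable (Ψ j)) (hη : ∀ j < q, Measurable (η j)) :
    Measurable fun ω => noiseSum (fun j => Ψ j ω) (fun j => η j ω) q := by
  unfold noiseSum
  exact Finset.measurable_sum _ fun j hj =>
    (hη j (Finset.mem_range.1 hj)).smul (hΨ j (Finset.mem_range.1 hj))

lemma measurable_expProcess {Ω : Type*} [mΩ : MeasurableSpace Ω] (σ : ℝ) {Ψ : ℕ → Ω → ι → ℝ}
    {η : ℕ → Ω → ℝ} {q : ℕ} (hΨ : ∀ j < q, Measurable (Ψ j)) (hη : ∀ j < q, Measurable (η j)) :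
    Measurable fun ω => expProcess σ (fun j => Ψ j ω) (fun j => η j ω) q := by
  unfold expProcess selfNorm
  have h1 := measurable_noiseSum hΨ hη
  exact ((measurable_dotProduct_inv (measurable_gram hΨ) h1 h1).div_const _).exp.div
    (measurable_matrix_det (measurable_gram hΨ)).sqrt

lemma lintegral_exp_map_le {Ω : Type*} [mΩ : MeasurableSpace Ω] {μ : Measure Ω} {σ : ℝ≥0}
    {ξ : Ω → ℝ} (hξ : Measurable ξ) (h : HasSubgaussianMGF ξ (σ ^ 2) μ) (t : ℝ) :
    ∫⁻ y, ENNReal.ofReal (Real.exp (t * y)) ∂(μ.map ξ)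
      ≤ ENNReal.ofReal (Real.exp ((σ : ℝ) ^ 2 * t ^ 2 / 2)) := by
  rw [lintegral_map (by fun_prop) hξ, ← ofReal_integral_eq_lintegral_ofReal
    (h.integrable_exp_mul t) (Filter.Eventually.of_forall fun _ => (Real.exp_pos _).le)]
  exact ENNReal.ofReal_le_ofReal (by simpa [mgf] using h.mgf_le t)

/-- The supermartingale property, tested on events of the past instead of through conditional
expectations. The new noise is independent of the past, so the integral factors over a product law
and the mixture bound handles the inner integral. -/
lemma setLIntegral_expProcess_succ_le {Ω : Type*} [mΩ : MeasurableSpace Ω] {μ : Measure Ω}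
    [IsProbabilityMeasure μ] {ℱ : Filtration ℕ mΩ} {σ : ℝ≥0} (hσ : 0 < σ) {η : ℕ → Ω → ℝ}
    (hη : IsNoise μ ℱ σ η) {Ψ : ℕ → Ω → ι → ℝ} (hΨ : ∀ q, Measurable[ℱ q] (Ψ q)) (q : ℕ)
    {B : Set Ω} (hB : MeasurableSet[ℱ q] B) :
    ∫⁻ ω in B, ENNReal.ofReal (expProcess σ (fun j => Ψ j ω) (fun j => η j ω) (q + 1)) ∂μ
      ≤ ∫⁻ ω in B, ENNReal.ofReal (expProcess σ (fun j => Ψ j ω) (fun j => η j ω) q) ∂μ := by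
  have hB' : MeasurableSet B := ℱ.le q _ hB
  have hΨq : ∀ j ≤ q, Measurable[ℱ q] (Ψ j) := fun j hj => (hΨ j).mono (ℱ.mono hj) le_rfl
  have hηq : ∀ j < q, Measurable[ℱ q] (η j) := fun j hj =>
    (hη.measurable j).mono (ℱ.mono hj) le_rfl
  have hηm : Measurable (η q) := (hη.measurable q).mono (ℱ.le _) le_rfl
  -- The event `B` is absorbed into `M`, so that the triple `(M, W, U)` carries everything needed
  -- from the past and independence is used only once.
  set M : Ω → ℝ≥0∞ := B.indicator
    fun ω => ENNReal.ofReal (expProcess σ (fun j => Ψ j ω) (fun j => η j ω) q) with hMdef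
  set W : Ω → ℝ := fun ω => width (fun j => Ψ j ω) q with hW
  set U : Ω → ℝ := fun ω => Ψ q ω ⬝ᵥ ((gram (fun j => Ψ j ω) q)⁻¹ *ᵥ
    noiseSum (fun j => Ψ j ω) (fun j => η j ω) q) with hU
  have hMm : Measurable[ℱ q] M := by
    refine Measurable.indicator ?_ hB
    exact (measurable_expProcess (mΩ := ℱ q) σ (fun j hj => hΨq j hj.le) hηq).ennreal_ofReal
  have hWm : Measurable[ℱ q] W :=
    measurable_dotProduct_inv (mΩ := ℱ q)
      (measurable_gram (mΩ := ℱ q) (fun j hj => hΨq j hj.le)) (hΨ q) (hΨ q)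
  have hUm : Measurable[ℱ q] U :=
    measurable_dotProduct_inv (mΩ := ℱ q)
      (measurable_gram (mΩ := ℱ q) (fun j hj => hΨq j hj.le)) (hΨ q)
      (measurable_noiseSum (mΩ := ℱ q) (fun j hj => hΨq j hj.le) hηq)
  set Z : Ω → ℝ≥0∞ × ℝ × ℝ := fun ω => (M ω, W ω, U ω) with hZ
  have hZq : Measurable[ℱ q] Z := hMm.prodMk (hWm.prodMk hUm)
  have hZm : Measurable Z := hZq.mono (ℱ.le q) le_rfl
  have hind : IndepFun Z (η q) μ := by
    rw [IndepFun_iff_Indep]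
    exact indep_of_indep_of_le_left (hη.indep q) hZq.comap_le
  set F : (ℝ≥0∞ × ℝ × ℝ) × ℝ → ℝ≥0∞ := fun p => p.1.1 * ENNReal.ofReal
    (Real.exp ((2 * p.2 * p.1.2.2 + p.2 ^ 2 * p.1.2.1 - p.1.2.2 ^ 2)
      / (2 * (σ : ℝ) ^ 2 * (1 + p.1.2.1))) / √(1 + p.1.2.1)) with hF
  have hFm : Measurable F := by
    rw [hF]
    fun_prop
  have hprod := (indepFun_iff_map_prod_eq_prod_map_map hZm.aemeasurable hηm.aemeasurable).1 hind
  have hν : IsProbabilityMeasure (μ.map (η q)) := Measure.isProbabilityMeasure_map hηm.aemeasurable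
  calc ∫⁻ ω in B, ENNReal.ofReal (expProcess σ (fun j => Ψ j ω) (fun j => η j ω) (q + 1)) ∂μ
      = ∫⁻ ω, F (Z ω, η q ω) ∂μ := by
        rw [← lintegral_indicator hB']
        refine lintegral_congr fun ω => ?_
        by_cases hω : ω ∈ B
        · simp only [Set.indicator_of_mem hω, hF, hZ, hMdef]
          rw [← ENNReal.ofReal_mul (expProcess_nonneg _ _ _ _), expProcess_succ]
        · simp [Set.indicator_of_notMem hω, hF, hZ, hMdef]
    _ = ∫⁻ z, ∫⁻ y, F (z, y) ∂(μ.map (η q)) ∂(μ.map Z) := by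
        rw [← lintegral_prod _ hFm.aemeasurable, ← hprod, lintegral_map hFm (hZm.prodMk hηm)]
    _ = ∫⁻ ω, ∫⁻ y, F (Z ω, y) ∂(μ.map (η q)) ∂μ :=
        lintegral_map hFm.lintegral_prod_right' hZm
    _ ≤ ∫⁻ ω, M ω ∂μ := by
        refine lintegral_mono fun ω => ?_
        have hw : 0 ≤ W ω := width_nonneg _ _
        have hs : 0 < √(1 + W ω) := Real.sqrt_pos.2 (by linarith)
        have h1 : ∀ y, F (Z ω, y) = M ω * ENNReal.ofReal (√(1 + W ω))⁻¹ * ENNReal.ofReal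
            (Real.exp ((2 * y * U ω + y ^ 2 * W ω - U ω ^ 2)
              / (2 * (σ : ℝ) ^ 2 * (1 + W ω)))) := by
          intro y
          simp only [hF, hZ]
          rw [div_eq_inv_mul, ENNReal.ofReal_mul (by positivity), mul_assoc (M ω)]
        simp_rw [h1]
        rw [lintegral_const_mul _ (by fun_prop)]
        calc _ ≤ M ω * ENNReal.ofReal (√(1 + W ω))⁻¹ * ENNReal.ofReal (√(1 + W ω)) := by
              gcongr
              exact lintegral_exp_update_le _ (NNReal.coe_pos.2 hσ)
                (lintegral_exp_map_le hηm (hη.subgaussian q)) hw _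
          _ = M ω := by
              rw [mul_assoc, ← ENNReal.ofReal_mul (by positivity), inv_mul_cancel₀ hs.ne',
                ENNReal.ofReal_one, mul_one]
    _ = _ := by rw [hMdef, lintegral_indicator hB']

/-- The self-normalized tail bound, uniformly over a finite horizon. -/
lemma measure_selfNorm_le {Ω : Type*} [mΩ : MeasurableSpace Ω] {μ : Measure Ω}
    [IsProbabilityMeasure μ] {ℱ : Filtration ℕ mΩ} {σ : ℝ≥0} (hσ : 0 < σ) {η : ℕ → Ω → ℝ}
    (hη : IsNoise μ ℱ σ η) {Ψ : ℕ → Ω → ι → ℝ} (hΨ : ∀ q, Measurable[ℱ q] (Ψ q)) {p : ℝ}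
    (hp : 0 < p) (Q : ℕ) :
    μ {ω | ∃ q < Q, (σ : ℝ) ^ 2 * (2 * Real.log (1 / p)
        + Real.log (gram (fun j => Ψ j ω) q).det) < selfNorm (fun j => Ψ j ω) (fun j => η j ω) q}
      ≤ ENNReal.ofReal p := by
  have hσ' : (0 : ℝ) < σ := NNReal.coe_pos.2 hσ
  have hηq : ∀ q, ∀ j < q, Measurable[ℱ q] (η j) := fun q j hj =>
    (hη.measurable j).mono (ℱ.mono hj) le_rfl
  have h := ville_finite μ ℱ
    (fun q ω => ENNReal.ofReal (expProcess σ (fun j => Ψ j ω) (fun j => η j ω) q))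
    (fun q => (measurable_expProcess (mΩ := ℱ q) σ
      (fun j hj => (hΨ j).mono (ℱ.mono hj.le) le_rfl) (hηq q)).ennreal_ofReal)
    (fun q B hB => setLIntegral_expProcess_succ_le hσ hη hΨ q hB) (ENNReal.ofReal (1 / p)) Q
  simp only [expProcess_zero, ENNReal.ofReal_one, lintegral_const, measure_univ, mul_one] at h
  have hc : ENNReal.ofReal p * ENNReal.ofReal (1 / p) = 1 := by
    rw [← ENNReal.ofReal_mul hp.le, mul_one_div_cancel hp.ne', ENNReal.ofReal_one]
  calc _ ≤ μ {ω | ∃ q < Q, ENNReal.ofReal (1 / p)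
            ≤ ENNReal.ofReal (expProcess σ (fun j => Ψ j ω) (fun j => η j ω) q)} := by
        refine measure_mono ?_
        rintro ω ⟨q, hq, hlt⟩
        refine ⟨q, hq, ENNReal.ofReal_le_ofReal ?_⟩
        have hdet := det_gram_pos (fun j => Ψ j ω) q
        rw [expProcess, le_div_iff₀ (Real.sqrt_pos.2 hdet), ← Real.log_le_iff_le_exp
          (by positivity), Real.log_mul (by positivity) (Real.sqrt_pos.2 hdet).ne',
          Real.log_sqrt hdet.le, le_div_iff₀ (by positivity)]
        nlinarith
    _ = ENNReal.ofReal p * (ENNReal.ofReal (1 / p) * μ {ω | ∃ q < Q, ENNReal.ofReal (1 / p)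
            ≤ ENNReal.ofReal (expProcess σ (fun j => Ψ j ω) (fun j => η j ω) q)}) := by
        rw [← mul_assoc, hc, one_mul]
    _ ≤ ENNReal.ofReal p * 1 := by gcongr
    _ = ENNReal.ofReal p := mul_one _

end Martingale

/-! ### Polynomials on the cube -/

lemma mem_multiIndices {d r : ℕ} {s : Fin d → ℕ} : s ∈ multiIndices d r ↔ ∑ i, s i ≤ r := by
  simp [multiIndices, Finset.mem_piAntidiag]

/-- `W j` recovers the coefficient of `t^j` of a polynomial of degree at most `r` from its values at
nodes in `[0,1]`. It is a row of the inverse Vandermonde matrix. The norm of `W 0` is exactly one,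
which is what keeps the dimension out of the constant in `exists_coeff_bound`. -/
lemma exists_interpolation_weights (r : ℕ) : ∃ (t : Fin (r + 1) → ℝ) (W : ℕ → Fin (r + 1) → ℝ)
    (Λ : ℝ), 1 ≤ Λ ∧ (∀ v, 0 ≤ t v ∧ t v ≤ 1) ∧
      (∀ j ≤ r, ∀ m ≤ r, ∑ v, W j v * t v ^ m = if j = m then 1 else 0) ∧
      (∑ v, |W 0 v| = 1) ∧ ∀ j ≤ r, ∑ v, |W j v| ≤ Λ := by
  set t : Fin (r + 1) → ℝ := fun v => (v : ℝ) / (r + 1) with ht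
  have hr : (0 : ℝ) < r + 1 := by positivity
  have hinj : Function.Injective t := by
    intro a b h
    simp only [ht] at h
    rw [div_left_inj' hr.ne'] at h
    exact Fin.ext (by exact_mod_cast h)
  set V := Matrix.vandermonde t
  have hV : IsUnit V.det := isUnit_iff_ne_zero.2 (Matrix.det_vandermonde_ne_zero_iff.2 hinj)
  have hVV := Matrix.nonsing_inv_mul V hV
  -- The node of index `0` is the point `0`, so evaluation there extracts the constant coefficient.
  set W : ℕ → Fin (r + 1) → ℝ := fun j =>
    if j = 0 then Pi.single 0 1 else V⁻¹ (Fin.ofNat (r + 1) j)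
    with hW
  refine ⟨t, W, 1 + ∑ j ∈ Finset.range (r + 1), ∑ v, |W j v|, ?_, ?_, ?_, ?_, ?_⟩
  · have : 0 ≤ ∑ j ∈ Finset.range (r + 1), ∑ v, |W j v| := by positivity
    linarith
  · intro v
    refine ⟨by positivity, ?_⟩
    rw [div_le_one hr]
    have := v.2
    exact_mod_cast this.le
  · intro j hj m hm
    by_cases h0 : j = 0
    · subst h0
      simp only [hW, if_true]
      rw [Finset.sum_eq_single 0 (fun b _ hb => by simp [hb]) (by simp)]
      rcases Nat.eq_zero_or_pos m with rfl | hm0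
      · simp
      · simp [ht, hm0.ne', hm0.ne]
    · have h := congrFun (congrFun hVV (Fin.ofNat (r + 1) j)) (Fin.ofNat (r + 1) m)
      rw [Matrix.mul_apply, Matrix.one_apply] at h
      have hmv : ((Fin.ofNat (r + 1) m : Fin (r + 1)) : ℕ) = m := Nat.mod_eq_of_lt (by omega)
      have hjv : ((Fin.ofNat (r + 1) j : Fin (r + 1)) : ℕ) = j := Nat.mod_eq_of_lt (by omega)
      simp only [Fin.ext_iff, hmv, hjv, V, Matrix.vandermonde_apply] at h
      simpa only [hW, if_neg h0] using h
  · simp only [hW, if_true]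
    rw [Finset.sum_eq_single 0 (fun b _ hb => by simp [hb]) (by simp)]
    simp
  · intro j hj
    have := Finset.single_le_sum (f := fun j => ∑ v, |W j v|) (fun j _ => by positivity)
      (Finset.mem_range.2 (Nat.lt_succ_of_le hj))
    linarith

/-- The coefficients of a polynomial of degree at most `r` are bounded by its supremum on the cube,
up to a constant that does not depend on the dimension. -/
lemma exists_coeff_bound (r : ℕ) : ∃ C : ℝ, 1 ≤ C ∧ ∀ (d : ℕ) (c : (Fin d → ℕ) → ℝ) (M : ℝ),
    (∀ x ∈ cube d, |∑ s ∈ multiIndices d r, c s * monomial s x| ≤ M) →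
    ∀ s ∈ multiIndices d r, |c s| ≤ C * M := by
  obtain ⟨t, W, Λ, hΛ, ht, hdual, hW0, hWΛ⟩ := exists_interpolation_weights r
  refine ⟨Λ ^ r, one_le_pow₀ hΛ, fun d c M hM s hs => ?_⟩
  have hle : ∀ m ∈ multiIndices d r, ∀ i, m i ≤ r := fun m hm i =>
    (Finset.single_le_sum (fun _ _ => Nat.zero_le _) (Finset.mem_univ i)).trans
      (mem_multiIndices.1 hm)
  have hM0 : 0 ≤ M := (abs_nonneg _).trans (hM 0 ⟨le_rfl, zero_le_one⟩)
  -- The tensor product of the one-dimensional functionals extracts the coefficient of `x^s` from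
  -- the values on the grid.
  have horth : ∀ m ∈ multiIndices d r, ∑ g : Fin d → Fin (r + 1),
      (∏ i, W (s i) (g i)) * monomial m (fun i => t (g i)) = if s = m then 1 else 0 := by
    intro m hm
    simp_rw [monomial, ← Finset.prod_mul_distrib]
    have := Finset.prod_univ_sum (fun _ : Fin d => (Finset.univ : Finset (Fin (r + 1))))
      (fun i v => W (s i) v * t v ^ m i)
    rw [Fintype.piFinset_univ] at this
    rw [← this, Finset.prod_congr rfl fun i _ => hdual (s i) (hle s hs i) (m i) (hle m hm i)]
    by_cases h : s = m
    · simp [h]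
    · rw [if_neg h]
      obtain ⟨i, hi⟩ := Function.ne_iff.1 h
      exact Finset.prod_eq_zero (Finset.mem_univ i) (if_neg hi)
  have hc : c s = ∑ g : Fin d → Fin (r + 1), (∏ i, W (s i) (g i)) *
      ∑ m ∈ multiIndices d r, c m * monomial m (fun i => t (g i)) := by
    simp_rw [Finset.mul_sum]
    rw [Finset.sum_comm]
    have : ∀ m ∈ multiIndices d r, ∑ g : Fin d → Fin (r + 1),
        (∏ i, W (s i) (g i)) * (c m * monomial m (fun i => t (g i)))
        = if s = m then c m else 0 := by
      intro m hm
      simp_rw [mul_left_comm _ (c m)]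
      rw [← Finset.mul_sum, horth m hm, mul_ite, mul_one, mul_zero]
    rw [Finset.sum_congr rfl this, Finset.sum_ite_eq, if_pos hs]
  calc |c s| ≤ ∑ g : Fin d → Fin (r + 1), (∏ i, |W (s i) (g i)|) * M := by
        rw [hc]
        refine (Finset.abs_sum_le_sum_abs _ _).trans (Finset.sum_le_sum fun g _ => ?_)
        rw [abs_mul, Finset.abs_prod]
        gcongr
        exact hM _ ⟨fun i => (ht _).1, fun i => (ht _).2⟩
    _ = (∏ i, ∑ v, |W (s i) v|) * M := by
        rw [← Finset.sum_mul]
        have := Finset.prod_univ_sum (fun _ : Fin d => (Finset.univ : Finset (Fin (r + 1))))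
          (fun i v => |W (s i) v|)
        rw [Fintype.piFinset_univ] at this
        rw [this]
    -- Coordinates with `s i = 0` cost a factor one, so the product is at most `Λ ^ |s|` whatever
    -- `d` is.
    _ ≤ (∏ i, Λ ^ s i) * M := by
        gcongr with i
        rcases Nat.eq_zero_or_pos (s i) with h | h
        · rw [h, hW0, pow_zero]
        · exact (hWΛ _ (hle s hs i)).trans (le_self_pow₀ hΛ h.ne')
    _ ≤ Λ ^ r * M := by
        rw [Finset.prod_pow_eq_pow_sum]
        exact mul_le_mul_of_nonneg_right (pow_le_pow_right₀ hΛ (mem_multiIndices.1 hs)) hM0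

/-- The Taylor polynomial is centred at `y`, the features at `0`; re-expanding does not raise the
total degree. -/
lemma exists_taylorPoly_coeff {d l r : ℕ} (hlr : l ≤ r) (f : (Fin d → ℝ) → ℝ) (y : Fin d → ℝ) :
    ∃ c : (Fin d → ℕ) → ℝ, ∀ x,
      taylorPoly l f y x = ∑ s ∈ multiIndices d r, c s * monomial s x := by
  set P : MvPolynomial (Fin d) ℝ := ∑ s ∈ multiIndices d l,
    MvPolynomial.C (partialDeriv s f y / ((∏ i, (s i).factorial : ℕ) : ℝ)) *
      ∏ i, (MvPolynomial.X i - MvPolynomial.C (y i)) ^ s i with hP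
  have hdeg : P.totalDegree ≤ r := by
    refine (MvPolynomial.totalDegree_finsetSum_le fun s hs => ?_).trans hlr
    refine (MvPolynomial.totalDegree_mul _ _).trans ?_
    rw [MvPolynomial.totalDegree_C, zero_add]
    refine (MvPolynomial.totalDegree_finsetProd _ _).trans ?_
    refine le_trans (Finset.sum_le_sum fun i _ => ?_) (mem_multiIndices.1 hs)
    refine (MvPolynomial.totalDegree_pow _ _).trans ?_
    have : (MvPolynomial.X i - MvPolynomial.C (y i) : MvPolynomial (Fin d) ℝ).totalDegree ≤ 1 :=
      (MvPolynomial.totalDegree_sub_C_le _ _).trans (MvPolynomial.totalDegree_X i).le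
    nlinarith
  refine ⟨fun s => P.coeff (Finsupp.equivFunOnFinite.symm s), fun x => ?_⟩
  have h1 : taylorPoly l f y x = MvPolynomial.eval x P := by
    rw [hP, taylorPoly, map_sum]
    refine Finset.sum_congr rfl fun s _ => ?_
    simp only [map_mul, MvPolynomial.eval_C, map_prod, map_pow, map_sub, MvPolynomial.eval_X,
      monomial, Pi.sub_apply]
    ring
  rw [h1, MvPolynomial.eval_eq']
  refine Finset.sum_bij_ne_zero (fun m _ _ => (m : Fin d → ℕ)) ?_ ?_ ?_ ?_
  · intro m hm _
    rw [mem_multiIndices]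
    have := MvPolynomial.le_totalDegree hm
    rw [Finsupp.sum_fintype _ _ fun _ => rfl] at this
    exact this.trans hdeg
  · intro a _ _ b _ _ h
    exact DFunLike.coe_injective h
  · intro s hs hne
    refine ⟨Finsupp.equivFunOnFinite.symm s, ?_, ?_, ?_⟩
    · rw [MvPolynomial.mem_support_iff]
      exact left_ne_zero_of_mul hne
    · simpa [monomial] using hne
    · simp
  · intro m _ _
    simp [monomial]

/-! ### Bins and local models -/

lemma bin_subset_cube {d N : ℕ} (k : Fin (N ^ d)) : (bin k : Set (Fin d → ℝ)) ⊆ cube d := by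
  intro x hx
  refine ⟨fun i => le_trans (by positivity) (hx i).1, fun i => (hx i).2.trans ?_⟩
  have h := (finFunctionFinEquiv.symm k i).2
  have hN : (0 : ℝ) < N := by exact_mod_cast (Nat.zero_le _).trans_lt h
  rw [Pi.one_apply, div_le_one hN]
  exact_mod_cast h

lemma exists_mem_bin {d N : ℕ} (hN : 1 ≤ N) {x : Fin d → ℝ} (hx : x ∈ cube d) :
    ∃ k : Fin (N ^ d), x ∈ bin k := by
  have hN0 : (0 : ℝ) < N := by exact_mod_cast hN
  have key : ∀ i, ∃ j : Fin N, ((j : ℕ) : ℝ) / N ≤ x i ∧ x i ≤ (((j : ℕ) : ℝ) + 1) / N := by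
    intro i
    have h0 : 0 ≤ x i := hx.1 i
    have h1 : x i ≤ 1 := hx.2 i
    simp_rw [div_le_iff₀ hN0, le_div_iff₀ hN0]
    rcases h1.lt_or_eq with h | h
    · have hlt : ⌊x i * N⌋₊ < N := by
        rw [Nat.floor_lt (by positivity)]
        nlinarith
      exact ⟨⟨_, hlt⟩, Nat.floor_le (by positivity), (Nat.lt_floor_add_one _).le⟩
    · refine ⟨⟨N - 1, by omega⟩, ?_, ?_⟩ <;> simp [h, Nat.cast_sub hN]
  choose g hg using key
  refine ⟨finFunctionFinEquiv g, fun i => ?_⟩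
  simp only [Equiv.symm_apply_apply]
  exact hg i

lemma norm_sub_le_of_mem_bin {d N : ℕ} {k : Fin (N ^ d)} {x y : Fin d → ℝ} (hx : x ∈ bin k)
    (hy : y ∈ bin k) : ‖x - y‖ ≤ (N : ℝ)⁻¹ := by
  rw [pi_norm_le_iff_of_nonneg (by positivity)]
  intro i
  have h1 := hx i
  have h2 := hy i
  rw [add_div, one_div] at h1 h2
  rw [Pi.sub_apply, Real.norm_eq_abs, abs_le]
  constructor <;> linarith

lemma norm_sub_le_of_mem_cube {d : ℕ} {x y : Fin d → ℝ} (hx : x ∈ cube d) (hy : y ∈ cube d) :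
    ‖x - y‖ ≤ 1 := by
  rw [pi_norm_le_iff_of_nonneg zero_le_one]
  intro i
  have h1 : 0 ≤ x i := hx.1 i
  have h2 : x i ≤ 1 := hx.2 i
  have h3 : 0 ≤ y i := hy.1 i
  have h4 : y i ≤ 1 := hy.2 i
  rw [Pi.sub_apply, Real.norm_eq_abs, abs_le]
  constructor <;> linarith

lemma misspec_eq {d N : ℕ} (hd : 1 ≤ d) (α L : ℝ) :
    misspec d N α L = L * (N : ℝ) ^ (-α) := by
  have hd' : (d : ℝ) ≠ 0 := by positivity
  rw [misspec, Nat.cast_pow, ← Real.rpow_natCast, ← Real.rpow_mul (Nat.cast_nonneg _)]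
  congr 2
  field_simp

lemma monomial_mem_Icc {d : ℕ} (s : Fin d → ℕ) {x : Fin d → ℝ} (hx : x ∈ cube d) :
    0 ≤ monomial s x ∧ monomial s x ≤ 1 :=
  ⟨Finset.prod_nonneg fun i _ => pow_nonneg (hx.1 i) _,
    Finset.prod_le_one (fun i _ => pow_nonneg (hx.1 i) _)
      fun i _ => pow_le_one₀ (hx.1 i) (hx.2 i)⟩

lemma feature_dotProduct_self_le {d : ℕ} (α : ℝ) {x : Fin d → ℝ} (hx : x ∈ cube d) :
    feature d α x ⬝ᵥ feature d α x ≤ Fintype.card (FeatureIdx d α) := by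
  calc feature d α x ⬝ᵥ feature d α x ≤ ∑ _s : FeatureIdx d α, (1 : ℝ) := by
        refine Finset.sum_le_sum fun s _ => ?_
        have := monomial_mem_Icc s.1 hx
        exact mul_le_one₀ this.2 this.1 this.2
    _ = _ := by simp

lemma feature_dotProduct {d : ℕ} (α : ℝ) (c : (Fin d → ℕ) → ℝ) (x : Fin d → ℝ) :
    feature d α x ⬝ᵥ (fun s : FeatureIdx d α => c s.1)
      = ∑ s ∈ multiIndices d (modelDegree α), c s * monomial s x := by
  rw [← Finset.sum_coe_sort]
  exact Finset.sum_congr rfl fun s _ => mul_comm _ _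

lemma card_featureIdx (d : ℕ) (α : ℝ) : Fintype.card (FeatureIdx d α) = linDim d α + 1 := by
  rw [Fintype.card_coe, linDim,
    ← Finset.card_filter_add_card_filter_not (s := multiIndices d (modelDegree α))
      (fun s => 1 ≤ ∑ i, s i)]
  congr 1
  rw [Finset.card_eq_one]
  refine ⟨0, ?_⟩
  ext s
  simp only [Finset.mem_filter, mem_multiIndices, Finset.mem_singleton]
  constructor
  · rintro ⟨-, h⟩
    have h0 : ∑ i, s i = 0 := by omega
    funext i
    exact Finset.sum_eq_zero_iff.1 h0 i (Finset.mem_univ i)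
  · rintro rfl
    simp

lemma one_le_linDim {d : ℕ} (hd : 1 ≤ d) (α : ℝ) : 1 ≤ linDim d α := by
  refine Finset.card_pos.2 ⟨Pi.single ⟨0, hd⟩ 1, ?_⟩
  have : ∑ i, (Pi.single ⟨0, hd⟩ 1 : Fin d → ℕ) i = 1 := by simp
  rw [Finset.mem_filter, mem_multiIndices, this]
  exact ⟨le_max_left _ _, le_rfl⟩

lemma card_featureIdx_le {d : ℕ} (hd : 1 ≤ d) (α : ℝ) :
    (Fintype.card (FeatureIdx d α) : ℝ) ≤ 2 * linDim d α := by
  have := one_le_linDim hd α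
  rw [card_featureIdx]
  exact_mod_cast (by omega : linDim d α + 1 ≤ 2 * linDim d α)

/-- On each bin a Hölder function is within the misspecification error of a linear function of the
features, whose coefficient vector is bounded independently of the bins and of the values of `d`. -/
lemma exists_local_model {α L : ℝ} (hα : 0 < α) (hL : 0 < L) : ∃ κ : ℝ, 0 < κ ∧
    ∀ (d N : ℕ), 1 ≤ d → 1 ≤ N → ∀ f : (Fin d → ℝ) → ℝ, (∀ x ∈ cube d, |f x| ≤ 1) →
      IsHolder α L f → ∀ k : Fin (N ^ d), ∃ θ : FeatureIdx d α → ℝ,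
        (∀ x ∈ bin k, |f x - feature d α x ⬝ᵥ θ| ≤ misspec d N α L) ∧
        θ ⬝ᵥ θ ≤ linDim d α * κ := by
  obtain ⟨C, hC1, hC⟩ := exists_coeff_bound (modelDegree α)
  refine ⟨2 * (C * (1 + L)) ^ 2, by positivity, fun d N hd hN f hf hH k => ?_⟩
  have hN0 : (0 : ℝ) < N := by exact_mod_cast hN
  set y : Fin d → ℝ := fun i => ((finFunctionFinEquiv.symm k i : ℕ) : ℝ) / N
  have hy : y ∈ bin k := by
    intro i
    refine ⟨le_rfl, ?_⟩
    simp only [y]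
    gcongr
    linarith
  have hyc := bin_subset_cube k hy
  obtain ⟨c, hc⟩ := exists_taylorPoly_coeff (le_max_right 1 (holderOrder α)) f y
  refine ⟨fun s => c s.1, fun x hx => ?_, ?_⟩
  · rw [feature_dotProduct, modelDegree, ← hc]
    refine (hH.taylor_le x (bin_subset_cube k hx) y hyc).trans ?_
    rw [misspec_eq hd, Real.rpow_neg hN0.le, ← Real.inv_rpow hN0.le]
    gcongr
    exact norm_sub_le_of_mem_bin hx hy
  · have hb : ∀ s ∈ multiIndices d (modelDegree α), |c s| ≤ C * (1 + L) := by
      -- The Taylor bound is used on the whole cube, not only on the bin. This makes the coefficient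
      -- bound independent of the size of the bin.
      refine hC d c (1 + L) fun x hx => ?_
      rw [modelDegree, ← hc]
      have h1 := hH.taylor_le x hx y hyc
      have h2 := hf x hx
      have h3 : ‖x - y‖ ^ α ≤ 1 :=
        Real.rpow_le_one (norm_nonneg _) (norm_sub_le_of_mem_cube hx hyc) hα.le
      have h4 : L * ‖x - y‖ ^ α ≤ L := by nlinarith
      rw [abs_le] at *
      constructor <;> linarith
    calc (fun s : FeatureIdx d α => c s.1) ⬝ᵥ (fun s => c s.1)
        ≤ ∑ _s : FeatureIdx d α, (C * (1 + L)) ^ 2 := by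
          refine Finset.sum_le_sum fun s _ => ?_
          rw [← sq]
          exact sq_le_sq' (abs_le.1 (hb s.1 s.2)).1 (abs_le.1 (hb s.1 s.2)).2
      _ = Fintype.card (FeatureIdx d α) * (C * (1 + L)) ^ 2 := by
          rw [Finset.sum_const, nsmul_eq_mul, Finset.card_univ]
      _ ≤ 2 * linDim d α * (C * (1 + L)) ^ 2 := by
          gcongr
          exact card_featureIdx_le hd α
      _ = _ := by ring

/-! ### Deterministic regret analysis -/

namespace Transcript

variable {d N : ℕ} (h : Transcript d N)

/-- The features of the queries to the bin `k`; queries to other bins contribute zero. -/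
def binFeature (α : ℝ) (k : Fin (N ^ d)) (j : ℕ) : FeatureIdx d α → ℝ :=
  if h.sel j = k then feature d α (h.act j) else 0

variable {h}

/-- Zero vectors leave the Gram matrix unchanged. Each bin can thus be followed in global time,
where the filtration lives, rather than at its own random query times. -/
lemma design_eq_gram (α : ℝ) (q : ℕ) (k : Fin (N ^ d)) :
    h.design α q k = gram (h.binFeature α k) q := by
  rw [design, gram, past, Finset.sum_filter]
  congr 1
  refine Finset.sum_congr rfl fun j _ => ?_
  by_cases hj : h.sel j = k <;> simp [binFeature, hj]

lemma sum_past {M : Type*} [AddCommMonoid M] (α : ℝ) (q : ℕ) (k : Fin (N ^ d))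
    (g : ℕ → (FeatureIdx d α → ℝ) → M) (hg : ∀ j, g j 0 = 0) :
    ∑ j ∈ h.past q k, g j (feature d α (h.act j))
      = ∑ j ∈ Finset.range q, g j (h.binFeature α k j) := by
  rw [past, Finset.sum_filter]
  refine Finset.sum_congr rfl fun j _ => ?_
  by_cases hj : h.sel j = k <;> simp [binFeature, hj, hg]

lemma estimate_eq (α : ℝ) (q : ℕ) (k : Fin (N ^ d)) :
    h.estimate α q k = (gram (h.binFeature α k) q)⁻¹ *ᵥ
      ∑ j ∈ Finset.range q, h.obs j • h.binFeature α k j := by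
  rw [estimate, design_eq_gram, sum_past α q k (fun j v => h.obs j • v) (by simp)]

/-- A feature vector has squared norm at most the number of features, so the average eigenvalue is
at most one plus the number of queries to the bin. -/
lemma log_det_gram_le {α : ℝ} {q : ℕ} {k : Fin (N ^ d)}
    (hact : ∀ j < q, h.act j ∈ bin (h.sel j)) :
    Real.log (gram (h.binFeature α k) q).det
      ≤ Fintype.card (FeatureIdx d α) * Real.log (1 + (h.past q k).card) := by
  refine log_det_le_of_trace_le (posDef_gram _ _) (by positivity) ?_
  rw [trace_gram, ← sum_past α q k (fun _ v => v ⬝ᵥ v) (by simp), mul_add, mul_one]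
  gcongr
  refine (Finset.sum_le_card_nsmul _ _ (Fintype.card (FeatureIdx d α) : ℝ) fun j hj => ?_).trans
    (by rw [nsmul_eq_mul, mul_comm])
  exact feature_dotProduct_self_le α
    (bin_subset_cube _ (hact j (Finset.mem_range.1 (Finset.mem_filter.1 hj).1)))

/-- Cauchy–Schwarz over the queries of the bin: the misspecification term of the confidence bound
costs `ε √t` times the width. -/
lemma sum_abs_le {α : ℝ} (q : ℕ) (k : Fin (N ^ d)) (v : FeatureIdx d α → ℝ) :
    ∑ j ∈ h.past q k, |v ⬝ᵥ ((gram (h.binFeature α k) q)⁻¹ *ᵥ feature d α (h.act j))|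
      ≤ √((h.past q k).card) * √(v ⬝ᵥ ((gram (h.binFeature α k) q)⁻¹ *ᵥ v)) := by
  rw [← Real.sqrt_mul (Nat.cast_nonneg _)]
  refine Real.le_sqrt_of_sq_le ((sq_sum_le_card_mul_sum_sq).trans ?_)
  gcongr
  simp_rw [sq_abs]
  rw [sum_past α q k (fun _ u => (v ⬝ᵥ ((gram (h.binFeature α k) q)⁻¹ *ᵥ u)) ^ 2) (by simp)]
  exact sum_sq_dotProduct_gram_inv_le _ _ _

/-- The confidence interval of the local estimates. -/
lemma abs_estimate_sub_le {α ε β : ℝ} {q : ℕ} {k : Fin (N ^ d)} {f : (Fin d → ℝ) → ℝ}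
    {ξ : ℕ → ℝ} {θ : FeatureIdx d α → ℝ} (hobs : ∀ j, h.obs j = f (h.act j) + ξ j)
    (hact : ∀ j < q, h.act j ∈ bin (h.sel j))
    (hθ : ∀ x ∈ bin k, |f x - feature d α x ⬝ᵥ θ| ≤ ε)
    (hθβ : θ ⬝ᵥ θ ≤ β / 4) (hξ : selfNorm (h.binFeature α k) ξ q ≤ β / 4)
    (v : FeatureIdx d α → ℝ) :
    |v ⬝ᵥ h.estimate α q k - v ⬝ᵥ θ|
      ≤ √β * √(v ⬝ᵥ ((gram (h.binFeature α k) q)⁻¹ *ᵥ v))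
        + ε * ∑ j ∈ h.past q k,
          |v ⬝ᵥ ((gram (h.binFeature α k) q)⁻¹ *ᵥ feature d α (h.act j))| := by
  set ψ := h.binFeature α k
  have hA := posDef_gram ψ q
  set e : ℕ → ℝ := fun j => f (h.act j) - feature d α (h.act j) ⬝ᵥ θ with he
  -- Linear model, regularization bias `-θ`, model error and noise.
  have hsum : ∑ j ∈ Finset.range q, h.obs j • ψ j
      = gram ψ q *ᵥ θ - θ + ∑ j ∈ Finset.range q, e j • ψ j + noiseSum ψ ξ q := by
    rw [gram_mulVec, add_sub_cancel_left, noiseSum, ← Finset.sum_add_distrib,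
      ← Finset.sum_add_distrib]
    refine Finset.sum_congr rfl fun j _ => ?_
    by_cases hj : h.sel j = k
    · have hψ : ψ j = feature d α (h.act j) := by simp [ψ, binFeature, hj]
      rw [← add_smul, ← add_smul, hobs, he, hψ]
      congr 1
      ring
    · have hψ : ψ j = 0 := by simp [ψ, binFeature, hj]
      simp [hψ]
  have hdiff : v ⬝ᵥ h.estimate α q k - v ⬝ᵥ θ = - (v ⬝ᵥ ((gram ψ q)⁻¹ *ᵥ θ))
      + ∑ j ∈ h.past q k, e j * (v ⬝ᵥ ((gram ψ q)⁻¹ *ᵥ feature d α (h.act j)))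
      + v ⬝ᵥ ((gram ψ q)⁻¹ *ᵥ noiseSum ψ ξ q) := by
    rw [sum_past α q k (fun j u => e j * (v ⬝ᵥ ((gram ψ q)⁻¹ *ᵥ u))) (by simp), estimate_eq, hsum,
      Matrix.mulVec_add, Matrix.mulVec_add, Matrix.mulVec_sub, inv_mulVec_eq hA rfl]
    simp only [dotProduct_add, dotProduct_sub]
    rw [← Matrix.mulVecLin_apply _ (∑ j ∈ Finset.range q, e j • ψ j), map_sum, dotProduct_sum]
    simp only [map_smul, Matrix.mulVecLin_apply, dotProduct_smul, smul_eq_mul]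
    ring
  -- The bias and the noise each receive half of `√β`, whence the hypotheses with `β / 4`.
  have hβ : √(β / 4) = √β / 2 := by
    rw [Real.sqrt_div' _ (by norm_num), show (4 : ℝ) = 2 ^ 2 by norm_num,
      Real.sqrt_sq (by norm_num)]
  have h1 : |v ⬝ᵥ ((gram ψ q)⁻¹ *ᵥ θ)| ≤ √(v ⬝ᵥ ((gram ψ q)⁻¹ *ᵥ v)) * (√β / 2) := by
    refine (abs_dotProduct_inv_le hA v θ).trans ?_
    gcongr
    rw [← hβ]
    exact Real.sqrt_le_sqrt ((dotProduct_gram_inv_le ψ q θ).trans hθβ)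
  have h2 : |v ⬝ᵥ ((gram ψ q)⁻¹ *ᵥ noiseSum ψ ξ q)|
      ≤ √(v ⬝ᵥ ((gram ψ q)⁻¹ *ᵥ v)) * (√β / 2) := by
    refine (abs_dotProduct_inv_le hA v _).trans ?_
    gcongr
    rw [← hβ]
    exact Real.sqrt_le_sqrt hξ
  have h3 : |∑ j ∈ h.past q k, e j * (v ⬝ᵥ ((gram ψ q)⁻¹ *ᵥ feature d α (h.act j)))|
      ≤ ε * ∑ j ∈ h.past q k, |v ⬝ᵥ ((gram ψ q)⁻¹ *ᵥ feature d α (h.act j))| := by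
    rw [Finset.mul_sum]
    refine (Finset.abs_sum_le_sum_abs _ _).trans (Finset.sum_le_sum fun j hj => ?_)
    rw [abs_mul]
    gcongr
    have hj' := Finset.mem_filter.1 hj
    refine hθ _ ?_
    rw [← hj'.2]
    exact hact j (Finset.mem_range.1 hj'.1)
  rw [hdiff]
  refine (abs_add_le _ _).trans ?_
  refine (add_le_add_left (abs_add_le _ _) _).trans ?_
  rw [abs_neg]
  linarith

lemma card_past_add {α L σ δ : ℝ} {T : ℕ} (hfol : h.FollowsUCBMeta α L σ δ T) (τ : ℕ)
    (k : Fin (N ^ d)) : (h.past (N ^ d + τ) k).card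
      = 1 + ((Finset.range τ).filter fun i => h.sel (N ^ d + i) = k).card := by
  rw [past, Finset.card_filter, Finset.card_filter, Finset.sum_range_add]
  congr 1
  have : ∀ j ∈ Finset.range (N ^ d),
      (if h.sel j = k then 1 else 0) = if (k : ℕ) = j then 1 else 0 := by
    intro j hj
    rw [hfol.sel_init j (Finset.mem_range.1 hj)]
    simp only [Fin.ext_iff, eq_comm]
  rw [Finset.sum_congr rfl this, Finset.sum_ite_eq, if_pos (Finset.mem_range.2 k.2)]

/-- The regret of one round, with the confidence width clipped at one. -/
lemma round_regret_le {α L σ δ : ℝ} {T : ℕ} (hN : 1 ≤ N) (hL : 0 < L)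
    (hfol : h.FollowsUCBMeta α L σ δ T)
    {f : (Fin d → ℝ) → ℝ} {xstar : Fin d → ℝ} (hf : ∀ x ∈ cube d, |f x| ≤ 1)
    (hxs : xstar ∈ cube d) {ξ : ℕ → ℝ} (hobs : ∀ j, h.obs j = f (h.act j) + ξ j)
    {θ : Fin (N ^ d) → FeatureIdx d α → ℝ}
    (hθ : ∀ k, ∀ x ∈ bin k, |f x - feature d α x ⬝ᵥ θ k| ≤ misspec d N α L)
    {q : ℕ} (hq : N ^ d ≤ q) (hqT : q < N ^ d + T)
    (hθβ : ∀ k, θ k ⬝ᵥ θ k ≤ radius d N α σ δ (h.past q k).card / 4)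
    (hξ : ∀ k, selfNorm (h.binFeature α k) ξ q ≤ radius d N α σ δ (h.past q k).card / 4) :
    f xstar - f (h.act q) ≤ 2 * misspec d N α L
      + (2 + 2 * √(radius d N α σ δ (h.past q (h.sel q)).card))
        * min 1 √(width (h.binFeature α (h.sel q)) q)
      + 2 * misspec d N α L * (√((h.past q (h.sel q)).card)
        * min 1 √(width (h.binFeature α (h.sel q)) q)) := by
  have hact : ∀ j < q, h.act j ∈ bin (h.sel j) := fun j hj => hfol.act_mem j (hj.trans hqT)
  have hconf := fun k v => abs_estimate_sub_le (v := v) hobs hact (hθ k) (hθβ k) (hξ k)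
  have hε : 0 ≤ misspec d N α L := by unfold misspec; positivity
  have hxq := hfol.act_mem q hqT
  have hself : h.binFeature α (h.sel q) q = feature d α (h.act q) := by simp [binFeature]
  obtain ⟨k, hk⟩ := exists_mem_bin hN hxs
  have hsel := hfol.sel_max q hq hqT k xstar hk
  have hS := sum_abs_le (h := h) q (h.sel q) (feature d α (h.act q))
  have h1 := hconf k (feature d α xstar)
  have h2 := hconf (h.sel q) (feature d α (h.act q))
  have h3 := hθ k xstar hk
  have h4 := hθ (h.sel q) (h.act q) hxq
  have h5 := hf xstar hxs
  have h6 := hf _ (bin_subset_cube _ hxq)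
  rw [abs_le] at h1 h2 h3 h4 h5 h6
  simp only [ucb, design_eq_gram] at hsel
  rw [width, hself]
  set w := feature d α (h.act q) ⬝ᵥ
    ((gram (h.binFeature α (h.sel q)) q)⁻¹ *ᵥ feature d α (h.act q))
  set b := √(radius d N α σ δ (h.past q (h.sel q)).card)
  set t := √((h.past q (h.sel q)).card : ℝ)
  set ε := misspec d N α L
  have hb : 0 ≤ b := Real.sqrt_nonneg _
  have ht : 0 ≤ t := Real.sqrt_nonneg _
  have hS' := mul_le_mul_of_nonneg_left hS hε
  -- For width at most one, chain the two confidence intervals through `hsel`. Otherwise the trivial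
  -- bound `2` applies; it is the `2` in the factor `2 + 2√β`.
  rcases le_total (√w) 1 with hw | hw
  · rw [min_eq_right hw]
    have : 0 ≤ √w := Real.sqrt_nonneg _
    linarith
  · rw [min_eq_left hw]
    have : 0 ≤ ε * t := mul_nonneg hε ht
    linarith

/-- The sum of the clipped widths over the rounds, weighted and unweighted. -/
lemma sum_round_widths_le {α L σ δ : ℝ} {T : ℕ} (hfol : h.FollowsUCBMeta α L σ δ T) :
    (∑ τ ∈ Finset.range T, min 1 √(width (h.binFeature α (h.sel (N ^ d + τ))) (N ^ d + τ))
      ≤ √T * √(N ^ d * (2 * (Fintype.card (FeatureIdx d α) * Real.log (T + 2))))) ∧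
    (∑ τ ∈ Finset.range T, √((h.past (N ^ d + τ) (h.sel (N ^ d + τ))).card) *
        min 1 √(width (h.binFeature α (h.sel (N ^ d + τ))) (N ^ d + τ))
      ≤ T * √(2 * (Fintype.card (FeatureIdx d α) * Real.log (T + 2)))) := by
  set n := N ^ d with hn
  set P := 2 * (Fintype.card (FeatureIdx d α) * Real.log ((T : ℝ) + 2)) with hP
  set s : ℕ → Fin n := fun τ => h.sel (n + τ) with hs
  set m : ℕ → ℝ := fun τ => min 1 √(width (h.binFeature α (s τ)) (n + τ)) with hm
  set F : Fin n → Finset ℕ := fun k => (Finset.range T).filter fun τ => s τ = k with hF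
  have hm0 : ∀ τ, 0 ≤ m τ := fun τ => le_min zero_le_one (Real.sqrt_nonneg _)
  have hm2 : ∀ τ, m τ ^ 2 = min 1 (width (h.binFeature α (s τ)) (n + τ)) := by
    intro τ
    have hw := width_nonneg (h.binFeature α (s τ)) (n + τ)
    rcases le_total (width (h.binFeature α (s τ)) (n + τ)) 1 with h1 | h1
    · simp only [hm]
      rw [min_eq_right h1, min_eq_right (Real.sqrt_le_one.2 h1), Real.sq_sqrt hw]
    · simp only [hm]
      rw [min_eq_left h1, min_eq_left (Real.one_le_sqrt.2 h1), one_pow]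
  -- Elliptical potential of one bin. It receives at most `T + 1` queries, the initial one included,
  -- which gives `log (T + 2)`.
  have hpot : ∀ k, ∑ τ ∈ F k, m τ ^ 2 ≤ P := by
    intro k
    calc ∑ τ ∈ F k, m τ ^ 2 = ∑ τ ∈ F k, min 1 (width (h.binFeature α k) (n + τ)) := by
          refine Finset.sum_congr rfl fun τ hτ => ?_
          rw [hm2, (Finset.mem_filter.1 hτ).2]
      _ ≤ ∑ τ ∈ Finset.range T, min 1 (width (h.binFeature α k) (n + τ)) :=
          Finset.sum_le_sum_of_subset_of_nonneg (Finset.filter_subset _ _)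
            fun _ _ _ => le_min zero_le_one (width_nonneg _ _)
      _ ≤ ∑ j ∈ Finset.range (n + T), min 1 (width (h.binFeature α k) j) := by
          rw [Finset.sum_range_add]
          exact le_add_of_nonneg_left
            (Finset.sum_nonneg fun _ _ => le_min zero_le_one (width_nonneg _ _))
      _ ≤ 2 * Real.log (gram (h.binFeature α k) (n + T)).det := sum_min_width_le _ _
      _ ≤ P := by
          rw [hP]
          gcongr
          refine (log_det_gram_le hfol.act_mem).trans ?_
          refine mul_le_mul_of_nonneg_left (Real.log_le_log (by positivity) ?_) (by positivity)
          rw [card_past_add hfol]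
          have : ((Finset.range T).filter fun i => h.sel (N ^ d + i) = k).card ≤ T := by
            simpa using Finset.card_filter_le (Finset.range T) fun i => h.sel (N ^ d + i) = k
          have : (((Finset.range T).filter fun i => h.sel (N ^ d + i) = k).card : ℝ) ≤ T := by
            exact_mod_cast this
          push_cast
          linarith
  have hfib : ∀ g : ℕ → ℝ, ∑ τ ∈ Finset.range T, g τ = ∑ k, ∑ τ ∈ F k, g τ := fun g =>
    (Finset.sum_fiberwise _ s g).symm
  constructor
  · calc ∑ τ ∈ Finset.range T, m τ = ∑ τ ∈ Finset.range T, 1 * m τ := by simp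
      _ ≤ √(∑ τ ∈ Finset.range T, (1 : ℝ) ^ 2) * √(∑ τ ∈ Finset.range T, m τ ^ 2) :=
          Real.sum_mul_le_sqrt_mul_sqrt _ _ _
      _ ≤ √T * √(N ^ d * P) := by
          gcongr
          · simp
          · rw [hfib]
            refine (Finset.sum_le_card_nsmul _ _ P fun k _ => hpot k).trans ?_
            rw [Finset.card_univ, Fintype.card_fin, nsmul_eq_mul, hn, Nat.cast_pow]
  · calc ∑ τ ∈ Finset.range T, √((h.past (n + τ) (s τ)).card) * m τ
        = ∑ k, ∑ τ ∈ F k, √((h.past (n + τ) (s τ)).card) * m τ := hfib _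
      -- Within a bin each count is at most `(F k).card`, so the counts sum to at most its square.
      -- Cauchy–Schwarz inside the bin then yields a total `T √P` without a factor `n`.
      _ ≤ ∑ k, (F k).card * √P := by
          refine Finset.sum_le_sum fun k _ => ?_
          refine (Real.sum_mul_le_sqrt_mul_sqrt _ _ _).trans ?_
          refine mul_le_mul ?_ (Real.sqrt_le_sqrt (hpot k)) (Real.sqrt_nonneg _)
            (Nat.cast_nonneg _)
          refine Real.sqrt_le_iff.2 ⟨Nat.cast_nonneg _, ?_⟩
          rw [sq, ← nsmul_eq_mul]
          refine Finset.sum_le_card_nsmul _ _ _ fun τ hτ => ?_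
          rw [Real.sq_sqrt (Nat.cast_nonneg _), Nat.cast_le]
          obtain ⟨hτT, hτk⟩ := Finset.mem_filter.1 hτ
          -- The initial query adds one, but round `τ` lies in `F k` and is not among its
          -- predecessors; the strict inclusion compensates.
          rw [card_past_add hfol, add_comm, Nat.succ_le_iff]
          refine Finset.card_lt_card ((Finset.ssubset_iff_of_subset ?_).2 ⟨τ, hτ, by simp⟩)
          intro i hi
          obtain ⟨hi1, hi2⟩ := Finset.mem_filter.1 hi
          refine Finset.mem_filter.2 ⟨?_, hi2.trans hτk⟩
          rw [Finset.mem_range] at *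
          omega
      _ = T * √P := by
          rw [← Finset.sum_mul, ← Nat.cast_sum,
            ← Finset.card_eq_sum_card_fiberwise (fun _ _ => Finset.mem_coe.2 (Finset.mem_univ _)),
            Finset.card_range]

lemma radius_mono {α σ δ : ℝ} (hN : 1 ≤ N) (hδ : 0 < δ) (hδ1 : δ < 1) {s t : ℕ} (hst : s ≤ t) :
    radius d N α σ δ s ≤ radius d N α σ δ t := by
  have hn : (1 : ℝ) ≤ ((N ^ d : ℕ) : ℝ) := by exact_mod_cast Nat.one_le_pow _ _ hN
  have hst' : (s : ℝ) ≤ t := by exact_mod_cast hst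
  have hp : 0 < δ / ((N ^ d : ℕ) : ℝ) := by positivity
  have hp1 : δ / ((N ^ d : ℕ) : ℝ) ≤ 1 := by
    rw [div_le_one (by positivity)]
    linarith
  unfold radius
  have h1 : 0 ≤ Real.log (1 + (s : ℝ)) := Real.log_nonneg (by linarith [Nat.cast_nonneg (α := ℝ) s])
  have h2 : 0 ≤ Real.log (4 * ((s : ℝ) + 1) ^ 2 / (δ / ((N ^ d : ℕ) : ℝ))) := by
    refine Real.log_nonneg ?_
    rw [le_div_iff₀ hp]
    nlinarith [Nat.cast_nonneg (α := ℝ) s]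
  have h3 : 0 ≤ Real.log (1 + (t : ℝ)) := h1.trans (by gcongr)
  gcongr

end Transcript

/-! ### Explicit constants -/

lemma two_thirds_le_log {T : ℝ} (hT : 2 ≤ T) : 2 / 3 ≤ Real.log T := by
  have := Real.log_two_gt_d9
  have := Real.log_le_log (by norm_num) hT
  linarith

lemma log_add_two_le {T : ℝ} (hT : 2 ≤ T) : Real.log (T + 2) ≤ 2 * Real.log T := by
  rw [show 2 * Real.log T = Real.log (T ^ 2) by simp]
  exact Real.log_le_log (by linarith) (by nlinarith)

/-- Here `l` and `G` stand for `ln T` and `ln (T²n/δ)`, `l₁` and `H` for the logarithms in the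
radius, `l₂` for the one in the potential. The constants come from `2·2·2 ≤ 3²`, `128·2·3 ≤ 28²` and
`3·(3 + 56σ) = 9 + 168σ`. -/
lemma width_terms_le {σ d' D n T l G l₁ l₂ H : ℝ} (hσ : 0 < σ) (hd' : 1 ≤ d')
    (hD : D ≤ 2 * d') (hn : 1 ≤ n) (hT : 2 ≤ T) (hl : 2 / 3 ≤ l) (hG : 4 / 3 ≤ G)
    (hl₁ : l₁ ≤ 2 * l) (hl₂ : l₂ ≤ 2 * l) (hl₂0 : 0 ≤ l₂) (hH : H ≤ 3 * G)
    (hH0 : 0 ≤ H) :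
    √(2 * (D * l₂)) ≤ 3 * (d' * √l) ∧
    (2 + 2 * √(128 * σ ^ 2 * d' * l₁ * H)) * (√T * √(n * (2 * (D * l₂))))
      ≤ (9 + 168 * σ) * (d' * l * √(T * n * G)) := by
  have hl0 : 0 < l := by linarith
  have hGp : 0 < G := by linarith
  have hd0 : 0 < d' := by linarith
  have hdlp : 0 < d' * l := by positivity
  have hP8 : 2 * (D * l₂) ≤ 9 * (d' * l) := by
    have h1 : D * l₂ ≤ 2 * d' * (2 * l) := mul_le_mul hD hl₂ hl₂0 (by positivity)
    linarith
  generalize 2 * (D * l₂) = P at hP8 ⊢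
  have h9 : √(9 : ℝ) = 3 := by rw [show (9 : ℝ) = 3 ^ 2 by norm_num, Real.sqrt_sq (by norm_num)]
  constructor
  · refine (Real.sqrt_le_sqrt hP8).trans ?_
    rw [Real.sqrt_mul (by norm_num), h9, Real.sqrt_mul hd0.le]
    gcongr
    rw [Real.sqrt_le_left hd0.le]
    exact le_self_pow₀ hd' (by norm_num)
  have hsTP : √T * √(n * P) ≤ 3 * √(d' * l * (T * n)) := by
    rw [← Real.sqrt_mul (by linarith), ← h9, ← Real.sqrt_mul (by norm_num)]
    refine Real.sqrt_le_sqrt ?_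
    have := mul_le_mul_of_nonneg_left hP8 (by positivity : 0 ≤ T * n)
    linarith
  have hsβ : √(128 * σ ^ 2 * d' * l₁ * H) ≤ 28 * σ * √(d' * l * G) := by
    refine Real.sqrt_le_iff.2 ⟨by positivity, ?_⟩
    rw [mul_pow, Real.sq_sqrt (by positivity)]
    have h1 : l₁ * H ≤ 2 * l * (3 * G) := mul_le_mul hl₁ hH hH0 (by positivity)
    have h2 := mul_le_mul_of_nonneg_left h1 (by positivity : 0 ≤ 128 * σ ^ 2 * d')
    have h3 : 0 < σ ^ 2 * (d' * l * G) := by positivity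
    linarith
  have h2 : 2 ≤ 3 * √(d' * l * G) := by
    have h1 : 2 / 3 ≤ d' * l := by nlinarith
    have : (2 / 3 : ℝ) ≤ √(d' * l * G) := Real.le_sqrt_of_sq_le (by nlinarith)
    linarith
  have hprod : √(d' * l * G) * √(d' * l * (T * n)) = d' * l * √(T * n * G) := by
    rw [← Real.sqrt_mul (by positivity), show d' * l * G * (d' * l * (T * n))
      = (d' * l) ^ 2 * (T * n * G) by ring, Real.sqrt_mul (by positivity),
      Real.sqrt_sq (by positivity)]
  have h3 : 2 + 2 * √(128 * σ ^ 2 * d' * l₁ * H) ≤ (3 + 56 * σ) * √(d' * l * G) := by linarith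
  refine (mul_le_mul h3 hsTP (by positivity) (by positivity)).trans (le_of_eq ?_)
  rw [← hprod]
  ring

lemma two_mul_log_le_log {T n δ : ℝ} (hn : 1 ≤ n) (hT : 2 ≤ T) (hδ : 0 < δ) (hδ1 : δ < 1) :
    2 * Real.log T ≤ Real.log (T ^ 2 * n / δ) := by
  have hnδ : 1 ≤ n / δ := by rw [le_div_iff₀ hδ]; linarith
  rw [mul_div_assoc, Real.log_mul (by positivity) (by positivity), Real.log_pow]
  have := Real.log_nonneg hnδ
  push_cast
  linarith

lemma log_radius_le {T n δ : ℝ} (hn : 1 ≤ n) (hT : 2 ≤ T) (hδ : 0 < δ) (hδ1 : δ < 1) :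
    Real.log (4 * (T + 1) ^ 2 / (δ / n)) ≤ 3 * Real.log (T ^ 2 * n / δ) := by
  have hnδ : 1 ≤ n / δ := by rw [le_div_iff₀ hδ]; linarith
  have h1 : 3 * Real.log (T ^ 2 * n / δ) = Real.log ((T ^ 2 * n / δ) ^ 3) := by
    rw [Real.log_pow]; norm_num
  rw [h1]
  refine Real.log_le_log (by positivity) ?_
  have h2 : 4 * (T + 1) ^ 2 / (δ / n) = 4 * (T + 1) ^ 2 * (n / δ) := by field_simp
  have h3 : (T ^ 2 * n / δ) ^ 3 = (T ^ 2) ^ 3 * (n / δ) ^ 3 := by rw [mul_div_assoc, mul_pow]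
  rw [h2, h3]
  have h4 : 4 ≤ T ^ 2 := by nlinarith
  have h5 : 4 * (T + 1) ^ 2 ≤ (T ^ 2) ^ 3 := by
    have h6 : 4 * (T + 1) ^ 2 ≤ 9 * T ^ 2 := by nlinarith
    nlinarith [mul_le_mul h4 h4 (by norm_num) (by positivity)]
  exact mul_le_mul h5 (le_self_pow₀ hnδ (by norm_num)) (by positivity) (by positivity)

/-- The leading-order form of the explicit regret bound. -/
lemma explicit_bound_le {σ d' D n T δ ε : ℝ} (hσ : 0 < σ) (hd' : 1 ≤ d')
    (hD : D ≤ 2 * d') (hn : 1 ≤ n) (hT : 2 ≤ T) (hδ : 0 < δ) (hδ1 : δ < 1) (hε : 0 ≤ ε) :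
    2 * ε * T
      + (2 + 2 * √(128 * σ ^ 2 * d' * Real.log (1 + T) * Real.log (4 * (T + 1) ^ 2 / (δ / n))))
        * (√T * √(n * (2 * (D * Real.log (T + 2)))))
      + 2 * ε * (T * √(2 * (D * Real.log (T + 2))))
      ≤ (9 + 168 * σ) * (d' * Real.log T * √(T * n * Real.log (T ^ 2 * n / δ))
          + d' * ε * T * √(Real.log T)) := by
  have hl := two_thirds_le_log hT
  have hl2 := log_add_two_le hT
  have hl1 : Real.log (1 + T) ≤ 2 * Real.log T :=
    (Real.log_le_log (by linarith) (by linarith)).trans hl2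
  have hH0 : 0 ≤ Real.log (4 * (T + 1) ^ 2 / (δ / n)) := by
    refine Real.log_nonneg ?_
    rw [le_div_iff₀ (by positivity), one_mul]
    have : δ / n ≤ 1 := by rw [div_le_one (by positivity)]; linarith
    nlinarith
  have hG := two_mul_log_le_log hn hT hδ hδ1
  obtain ⟨h1, h2⟩ := width_terms_le hσ hd' hD hn hT hl (by linarith) hl1 hl2
    (Real.log_nonneg (by linarith))
    (log_radius_le hn hT hδ hδ1) hH0
  have hsl : (2 / 3 : ℝ) ≤ √(Real.log T) := Real.le_sqrt_of_sq_le (by linarith)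
  have hdl : 2 / 3 ≤ d' * √(Real.log T) := by nlinarith
  have hεT : 0 ≤ ε * T := by positivity
  have a1 := mul_le_mul_of_nonneg_left hdl hεT
  have a2 := mul_le_mul_of_nonneg_left h1 hεT
  have a4 : 9 * (d' * ε * T * √(Real.log T)) ≤ (9 + 168 * σ) * (d' * ε * T * √(Real.log T)) := by
    gcongr
    linarith
  linarith

/-- A confidence radius dominates the self-normalized noise and the regularization bias as soon as
there are sufficiently many bins. -/
lemma radius_dominates {d N : ℕ} {α σ δ κ : ℝ} (hd : 1 ≤ d) (hN : 1 ≤ N) (hδ : 0 < δ)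
    (hδ1 : δ < 1) (hκ : κ ≤ 16 * σ ^ 2 * Real.log (N ^ d : ℕ)) {t : ℕ} (ht : 1 ≤ t) :
    linDim d α * κ ≤ Transcript.radius d N α σ δ t / 4 ∧
    σ ^ 2 * (2 * Real.log (1 / (δ / (N ^ d : ℕ)))
      + Fintype.card (FeatureIdx d α) * Real.log (1 + t))
      ≤ Transcript.radius d N α σ δ t / 4 := by
  have hn : (1 : ℝ) ≤ ((N ^ d : ℕ) : ℝ) := by exact_mod_cast Nat.one_le_pow _ _ hN
  set n : ℝ := ((N ^ d : ℕ) : ℝ)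
  have ht' : (1 : ℝ) ≤ t := by exact_mod_cast ht
  have hD := card_featureIdx_le hd α
  have hd' : (1 : ℝ) ≤ linDim d α := by exact_mod_cast one_le_linDim hd α
  unfold Transcript.radius
  set d' : ℝ := (linDim d α : ℝ)
  set l := Real.log (1 + (t : ℝ))
  have hl : 2 / 3 ≤ l := two_thirds_le_log (by linarith)
  set G := Real.log (4 * ((t : ℝ) + 1) ^ 2 / (δ / n)) with hG
  have hlog : Real.log (1 / (δ / n)) = Real.log n + Real.log (1 / δ) := by
    rw [← Real.log_mul (by positivity) (by positivity)]
    congr 1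
    field_simp
  have hG1 : Real.log (1 / (δ / n)) + 1 ≤ G := by
    rw [hG, div_eq_mul_one_div (4 * ((t : ℝ) + 1) ^ 2),
      Real.log_mul (by positivity) (by positivity)]
    have : Real.log (Real.exp 1) ≤ Real.log (4 * ((t : ℝ) + 1) ^ 2) := by
      refine Real.log_le_log (Real.exp_pos _) ?_
      have := Real.exp_one_lt_d9
      nlinarith
    rw [Real.log_exp] at this
    linarith
  have hlδ : 0 ≤ Real.log (1 / δ) := Real.log_nonneg (by rw [le_div_iff₀ hδ]; linarith)
  have hln : 0 ≤ Real.log n := Real.log_nonneg hn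
  have hGn : Real.log n ≤ G := by linarith
  have hs : 0 ≤ σ ^ 2 := sq_nonneg σ
  constructor
  -- A quarter of the radius is `32σ²d'lG`, and `l ≥ 1/2` gives `ln n ≤ 2lG`; this explains the `16`
  -- in the hypothesis on `κ`.
  · have h1 : d' * κ ≤ d' * (16 * σ ^ 2 * Real.log n) := by gcongr
    have h2 : Real.log n ≤ 2 * (l * G) := by nlinarith
    have h3 := mul_le_mul_of_nonneg_left h2 (by positivity : 0 ≤ 16 * σ ^ 2 * d')
    linarith
  · have hG' : 1 ≤ G := by linarith
    have hdl : 2 / 3 ≤ d' * l := by nlinarith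
    have h1 : 2 * Real.log (1 / (δ / n)) ≤ 3 * (d' * l * G) := by nlinarith
    have h2 : Fintype.card (FeatureIdx d α) * l ≤ 2 * (d' * l * G) := by
      have : (Fintype.card (FeatureIdx d α) : ℝ) * l ≤ 2 * d' * l := by gcongr
      nlinarith
    have h3 : 2 * Real.log (1 / (δ / n)) + Fintype.card (FeatureIdx d α) * l
        ≤ 32 * (d' * l * G) := by nlinarith
    have h4 := mul_le_mul_of_nonneg_left h3 hs
    linarith

/-! ### High-probability regret bounds -/

lemma regret_le_two_mul {d : ℕ} {f : (Fin d → ℝ) → ℝ} {xstar : Fin d → ℝ}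
    (hf : ∀ x ∈ cube d, |f x| ≤ 1) (hxs : xstar ∈ cube d) {x : ℕ → Fin d → ℝ} {a T : ℕ}
    (hx : ∀ τ < T, x (a + τ) ∈ cube d) : regret f xstar x a T ≤ 2 * T := by
  refine (Finset.sum_le_card_nsmul _ _ (2 : ℝ) fun τ hτ => ?_).trans (by simp [mul_comm])
  have h1 := abs_le.1 (hf _ (hx τ (Finset.mem_range.1 hτ)))
  have h2 := abs_le.1 (hf _ hxs)
  linarith

lemma regret_add {d : ℕ} (f : (Fin d → ℝ) → ℝ) (xstar : Fin d → ℝ) (x : ℕ → Fin d → ℝ)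
    (m T : ℕ) : regret f xstar x 0 (m + T) = regret f xstar x 0 m + regret f xstar x m T := by
  simp only [regret, Finset.sum_range_add, zero_add]

/-- The regret of the rounds whenever the confidence intervals hold. -/
lemma Transcript.regret_le {d N T : ℕ} {h : Transcript d N} {α L σ δ : ℝ} (hN : 1 ≤ N)
    (hL : 0 < L) (hδ : 0 < δ) (hδ1 : δ < 1) (hfol : h.FollowsUCBMeta α L σ δ T)
    {f : (Fin d → ℝ) → ℝ} {xstar : Fin d → ℝ} (hf : ∀ x ∈ cube d, |f x| ≤ 1)
    (hxs : xstar ∈ cube d) {ξ : ℕ → ℝ} (hobs : ∀ j, h.obs j = f (h.act j) + ξ j)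
    {θ : Fin (N ^ d) → FeatureIdx d α → ℝ}
    (hθ : ∀ k, ∀ x ∈ bin k, |f x - feature d α x ⬝ᵥ θ k| ≤ misspec d N α L)
    (hθβ : ∀ k, ∀ t, 1 ≤ t → θ k ⬝ᵥ θ k ≤ radius d N α σ δ t / 4)
    (hξ : ∀ k, ∀ q, N ^ d ≤ q → q < N ^ d + T →
      selfNorm (h.binFeature α k) ξ q ≤ radius d N α σ δ (h.past q k).card / 4) :
    regret f xstar h.act (N ^ d) T ≤ 2 * misspec d N α L * T
      + (2 + 2 * √(radius d N α σ δ T))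
        * (√T * √(N ^ d * (2 * (Fintype.card (FeatureIdx d α) * Real.log (T + 2)))))
      + 2 * misspec d N α L *
        (T * √(2 * (Fintype.card (FeatureIdx d α) * Real.log (T + 2)))) := by
  have hε : 0 ≤ misspec d N α L := by unfold misspec; positivity
  obtain ⟨hw1, hw2⟩ := sum_round_widths_le hfol
  calc regret f xstar h.act (N ^ d) T
      ≤ ∑ τ ∈ Finset.range T, (2 * misspec d N α L
        + (2 + 2 * √(radius d N α σ δ T))
          * min 1 √(width (h.binFeature α (h.sel (N ^ d + τ))) (N ^ d + τ))
        + 2 * misspec d N α L * (√((h.past (N ^ d + τ) (h.sel (N ^ d + τ))).card)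
          * min 1 √(width (h.binFeature α (h.sel (N ^ d + τ))) (N ^ d + τ)))) := by
        refine Finset.sum_le_sum fun τ hτ => ?_
        have hτT := Finset.mem_range.1 hτ
        refine (round_regret_le (q := N ^ d + τ) hN hL hfol hf hxs hobs hθ (by omega) (by omega)
          (fun k => hθβ k _ (by rw [card_past_add hfol]; omega))
          (fun k => hξ k _ (by omega) (by omega))).trans ?_
        have hr := Real.sqrt_le_sqrt (radius_mono (d := d) (α := α) (σ := σ) hN hδ hδ1
          (show (h.past (N ^ d + τ) (h.sel (N ^ d + τ))).card ≤ T by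
            have := Finset.card_filter_le (Finset.range τ)
              fun i => h.sel (N ^ d + i) = h.sel (N ^ d + τ)
            rw [Finset.card_range] at this
            rw [card_past_add hfol]
            omega))
        have h0 : 0 ≤ min 1 √(width (h.binFeature α (h.sel (N ^ d + τ))) (N ^ d + τ)) :=
          le_min zero_le_one (Real.sqrt_nonneg _)
        have := mul_le_mul_of_nonneg_right hr h0
        linarith
    _ ≤ _ := by
        rw [Finset.sum_add_distrib, Finset.sum_add_distrib, Finset.sum_const, Finset.card_range,
          nsmul_eq_mul, ← Finset.mul_sum, ← Finset.mul_sum,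
          mul_comm (T : ℝ) (2 * misspec d N α L)]
        gcongr

/-- The self-normalized bounds hold for all bins simultaneously. -/
lemma measure_noise_event_ge {Ω : Type*} [mΩ : MeasurableSpace Ω] {μ : Measure Ω}
    [IsProbabilityMeasure μ] {ℱ : Filtration ℕ mΩ} {d N T : ℕ} {α L δ : ℝ} {σ : ℝ≥0}
    (hσ : 0 < σ) (hN : 1 ≤ N) (hδ : 0 < δ) {f : (Fin d → ℝ) → ℝ} {η : ℕ → Ω → ℝ}
    {X : ℕ → Ω → Fin d → ℝ} {K : ℕ → Ω → Fin (N ^ d)} (hη : IsNoise μ ℱ σ η)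
    (hrun : IsRun ℱ α L σ δ T f η X K) :
    ENNReal.ofReal (1 - δ) ≤ μ {ω | ∀ k, ∀ q < N ^ d + T,
      selfNorm ((transcript f η X K ω).binFeature α k) (fun j => η j ω) q
        ≤ (σ : ℝ) ^ 2 * (2 * Real.log (1 / (δ / (N ^ d : ℕ)))
          + Real.log (gram ((transcript f η X K ω).binFeature α k) q).det)} := by
  have hn0 : (0 : ℝ) < (N ^ d : ℕ) := Nat.cast_pos.2 (Nat.one_le_pow _ _ hN)
  set Ψ : Fin (N ^ d) → ℕ → Ω → FeatureIdx d α → ℝ := fun k j ω =>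
    (transcript f η X K ω).binFeature α k j
  have hΨ : ∀ k q, Measurable[ℱ q] (Ψ k q) := by
    intro k q
    have h1 : Measurable[ℱ q] fun ω => feature d α (X q ω) := by
      refine Measurable.comp (g := feature d α) ?_ (hrun.measurable_act q)
      refine measurable_pi_lambda _ fun s => ?_
      unfold feature monomial
      fun_prop
    have h2 : MeasurableSet[ℱ q] {ω | K q ω = k} := by
      have : {ω | K q ω = k} = K q ⁻¹' {k} := by ext; simp
      rw [this]
      exact hrun.measurable_sel q (measurableSet_singleton k)
    exact Measurable.ite h2 h1 measurable_const
  set E : Set Ω := {ω | ∀ k, ∀ q < N ^ d + T, selfNorm (fun j => Ψ k j ω) (fun j => η j ω) q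
    ≤ (σ : ℝ) ^ 2 * (2 * Real.log (1 / (δ / (N ^ d : ℕ)))
      + Real.log (gram (fun j => Ψ k j ω) q).det)}
  have hE : μ Eᶜ ≤ ENNReal.ofReal δ := by
    calc μ Eᶜ ≤ μ (⋃ k, {ω | ∃ q < N ^ d + T, (σ : ℝ) ^ 2 * (2 * Real.log (1 / (δ / (N ^ d : ℕ)))
          + Real.log (gram (fun j => Ψ k j ω) q).det)
            < selfNorm (fun j => Ψ k j ω) (fun j => η j ω) q}) := by
          refine measure_mono fun ω hω => ?_
          simp only [E, Set.mem_compl_iff, Set.mem_ofPred_eq, not_forall, not_le] at hω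
          obtain ⟨k, q, hq, hlt⟩ := hω
          exact Set.mem_iUnion.2 ⟨k, q, hq, hlt⟩
      _ ≤ ∑ k, ENNReal.ofReal (δ / (N ^ d : ℕ)) := by
          refine (measure_iUnion_fintype_le _ _).trans (Finset.sum_le_sum fun k _ => ?_)
          exact measure_selfNorm_le hσ hη (hΨ k) (by positivity) _
      _ = ENNReal.ofReal δ := by
          rw [Finset.sum_const, Finset.card_univ, Fintype.card_fin, nsmul_eq_mul,
            ← ENNReal.ofReal_natCast, ← ENNReal.ofReal_mul hn0.le, mul_div_cancel₀ _ hn0.ne']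
  -- Subadditivity is enough, so measurability of `E` is not needed.
  have h1 : 1 ≤ μ E + ENNReal.ofReal δ := by
    calc (1 : ℝ≥0∞) = μ (E ∪ Eᶜ) := by rw [Set.union_compl_self, measure_univ]
      _ ≤ μ E + μ Eᶜ := measure_union_le _ _
      _ ≤ _ := by gcongr
  rw [ENNReal.ofReal_sub _ hδ.le, ENNReal.ofReal_one]
  exact tsub_le_iff_right.2 h1

lemma act_mem_cube {Ω : Type*} [mΩ : MeasurableSpace Ω] {ℱ : Filtration ℕ mΩ} {d N T : ℕ}
    {α L σ δ : ℝ} {f : (Fin d → ℝ) → ℝ} {η : ℕ → Ω → ℝ} {X : ℕ → Ω → Fin d → ℝ}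
    {K : ℕ → Ω → Fin (N ^ d)} (hrun : IsRun ℱ α L σ δ T f η X K) (ω : Ω) {q : ℕ}
    (hq : q < N ^ d + T) : X q ω ∈ cube d :=
  bin_subset_cube _ ((hrun.follows ω).act_mem q hq)

/-- With too few bins for the confidence radii to be valid, the misspecification error is bounded
below. -/
lemma le_misspec_of_log_lt {d N : ℕ} {α L c : ℝ} (hα : 0 < α) (hL : 0 < L) (hd : 1 ≤ d)
    (hN : 1 ≤ N) (h : Real.log (N ^ d : ℕ) < c) : L * Real.exp (-(α * c)) ≤ misspec d N α L := by
  have hN0 : (0 : ℝ) < N := by exact_mod_cast hN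
  have hlog : Real.log N ≤ Real.log (N ^ d : ℕ) := by
    refine Real.log_le_log hN0 ?_
    rw [Nat.cast_pow]
    exact le_self_pow₀ (by exact_mod_cast hN) (by omega)
  rw [misspec_eq hd, Real.rpow_def_of_pos hN0]
  gcongr
  nlinarith

/-- The bound for an arbitrary number `N ^ d` of bins. -/
lemma exists_regret_bound (α L : ℝ) (σ : ℝ≥0) (hα : 0 < α) (hL : 0 < L) (hσ : 0 < σ) :
    ∃ C : ℝ, 0 < C ∧
      ∀ (d N T : ℕ) (δ : ℝ), 1 ≤ d → 1 ≤ N → 2 ≤ T → 0 < δ → δ < 1 →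
      ∀ (f : (Fin d → ℝ) → ℝ) (xstar : Fin d → ℝ),
        (∀ x ∈ cube d, |f x| ≤ 1) → IsHolder α L f → xstar ∈ cube d →
      ∀ (Ω : Type*) [mΩ : MeasurableSpace Ω] (μ : Measure Ω) [IsProbabilityMeasure μ]
        (ℱ : Filtration ℕ mΩ) (η : ℕ → Ω → ℝ) (X : ℕ → Ω → Fin d → ℝ)
        (K : ℕ → Ω → Fin (N ^ d)),
        IsNoise μ ℱ σ η → IsRun ℱ α L σ δ T f η X K →
        let n : ℝ := (N : ℝ) ^ d
        let ε : ℝ := L * n ^ (-(α / (d : ℝ)))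
        let d' : ℝ := (linDim d α : ℝ)
        let bound : ℝ := C *
          (d' * Real.log T * Real.sqrt (T * n * Real.log ((T : ℝ) ^ 2 * n / δ))
            + d' * ε * T * Real.sqrt (Real.log T))
        ENNReal.ofReal (1 - δ) ≤
          μ {ω | regret f xstar (fun q => X q ω) (N ^ d) T ≤ bound ∧
            (N ^ d ≤ T → regret f xstar (fun q => X q ω) 0 (N ^ d + T) ≤ bound)} := by
  obtain ⟨κ, hκ, hmodel⟩ := exists_local_model hα hL
  have hσ' : (0 : ℝ) < σ := NNReal.coe_pos.2 hσ
  set c : ℝ := κ / (16 * (σ : ℝ) ^ 2) with hc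
  -- `c` is the value of `ln n` from which the radius is valid. Below it `C₂ * ε ≥ 6`, hence `C₂ *
  -- B₂ ≥ 4T`.
  set C₂ : ℝ := 6 / (L * Real.exp (-(α * c))) with hC₂
  have hC₂0 : 0 < C₂ := by positivity
  refine ⟨12 + 168 * σ + C₂, by positivity, ?_⟩
  intro d N T δ hd hN hT hδ hδ1 f xstar hf hH hxs Ω mΩ μ _ ℱ η X K hη hrun n ε d' bound
  have hn : (1 : ℝ) ≤ n := one_le_pow₀ (by exact_mod_cast hN)
  have hncast : ((N ^ d : ℕ) : ℝ) = n := Nat.cast_pow _ _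
  have hε : ε = misspec d N α L := by simp only [ε, misspec, hncast]
  have hε0 : 0 ≤ ε := by positivity
  have hT' : (2 : ℝ) ≤ T := by exact_mod_cast hT
  have hd' : 1 ≤ d' := Nat.one_le_cast.2 (one_le_linDim hd α)
  have hl := two_thirds_le_log hT'
  have hG := two_mul_log_le_log hn hT' hδ hδ1
  set l := Real.log (T : ℝ)
  set G := Real.log ((T : ℝ) ^ 2 * n / δ)
  set B₁ := d' * l * √(T * n * G) with hB₁
  set B₂ := d' * ε * T * √l with hB₂
  have hB₁0 : 0 ≤ B₁ := by positivity
  have hB₂0 : 0 ≤ B₂ := by positivity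
  have hsl : (2 / 3 : ℝ) ≤ √l := Real.le_sqrt_of_sq_le (by linarith)
  have hbound : bound = (12 + 168 * σ + C₂) * (B₁ + B₂) := rfl
  have hinit : ∀ ω, regret f xstar (fun q => X q ω) 0 (N ^ d) ≤ 2 * n := fun ω => by
    rw [← hncast]
    exact regret_le_two_mul hf hxs fun τ hτ => act_mem_cube hrun ω (by omega)
  by_cases hκn : κ ≤ 16 * (σ : ℝ) ^ 2 * Real.log (N ^ d : ℕ)
  · choose θ hθ hθκ using hmodel d N hd hN f hf hH
    refine (measure_noise_event_ge (T := T) hσ hN hδ hη hrun).trans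
      (measure_mono fun ω hω => ?_)
    have hfol := hrun.follows ω
    have hR : regret f xstar (fun q => X q ω) (N ^ d) T ≤ (9 + 168 * σ) * (B₁ + B₂) := by
      refine (Transcript.regret_le hN hL hδ hδ1 hfol hf hxs (fun _ => rfl) hθ
        (fun k t ht => (hθκ k).trans (radius_dominates hd hN hδ hδ1 hκn ht).1)
        (fun k q hq hqT => ?_)).trans ?_
      · have ht : 1 ≤ ((transcript f η X K ω).past q k).card := by
          obtain ⟨τ, rfl⟩ := Nat.exists_eq_add_of_le hq
          rw [Transcript.card_past_add hfol]
          omega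
        refine (hω k q hqT).trans (le_trans ?_ (radius_dominates hd hN hδ hδ1 hκn ht).2)
        gcongr
        exact Transcript.log_det_gram_le fun j hj => hfol.act_mem j (hj.trans hqT)
      · have := explicit_bound_le hσ' hd' (card_featureIdx_le hd α) hn hT' hδ hδ1 hε0
        rw [← hε]
        simpa only [Transcript.radius, hncast] using this
    have h9 : (9 + 168 * σ) * (B₁ + B₂) ≤ (12 + 168 * σ + C₂) * (B₁ + B₂) :=
      mul_le_mul_of_nonneg_right (by linarith) (by positivity)
    refine ⟨hR.trans (h9.trans_eq hbound.symm), fun hnT => ?_⟩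
    have hnT' : n ≤ T := by rw [← hncast]; exact_mod_cast hnT
    -- For `n ≤ T` the initial queries are absorbed by the first term; they raise the constant from
    -- `9` to `12`.
    have h2n : 2 * n ≤ 3 * B₁ := by
      have h1 : n ≤ √(T * n * G) := by
        refine Real.le_sqrt_of_sq_le ?_
        have : n * n ≤ T * n := by gcongr
        nlinarith
      have h2 : 2 / 3 ≤ d' * l := by nlinarith
      have : 2 / 3 * n ≤ B₁ := mul_le_mul h2 h1 (by positivity) (by positivity)
      linarith
    rw [regret_add, hbound]
    have := hinit ω
    have : 0 ≤ C₂ * (B₁ + B₂) := by positivity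
    linarith
  -- Too few bins: the trivial regret, `2T` for the rounds and `2n ≤ 2T` for the initial queries, is
  -- already below the bound.
  · have hεl : L * Real.exp (-(α * c)) ≤ ε := by
      rw [hε]
      refine le_misspec_of_log_lt hα hL hd hN ?_
      rw [hc, lt_div_iff₀ (by positivity)]
      linarith [not_le.1 hκn]
    have h4T : 4 * (T : ℝ) ≤ C₂ * B₂ := by
      have h1 : 6 ≤ C₂ * ε := by
        calc 6 = C₂ * (L * Real.exp (-(α * c))) := by rw [hC₂]; field_simp
          _ ≤ C₂ * ε := by gcongr
      have h2 : 2 / 3 ≤ d' * √l := by nlinarith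
      have h3 : 6 * (2 / 3) ≤ C₂ * ε * (d' * √l) := mul_le_mul h1 h2 (by norm_num) (by positivity)
      have h4 := mul_le_mul_of_nonneg_right h3 (by positivity : (0 : ℝ) ≤ T)
      rw [hB₂]
      linarith
    have hb : 4 * (T : ℝ) ≤ bound := by
      rw [hbound]
      have : 0 ≤ (12 + 168 * σ) * (B₁ + B₂) := by positivity
      have : 0 ≤ C₂ * B₁ := by positivity
      linarith
    have huniv : {ω | regret f xstar (fun q => X q ω) (N ^ d) T ≤ bound ∧
        (N ^ d ≤ T → regret f xstar (fun q => X q ω) 0 (N ^ d + T) ≤ bound)} = Set.univ := by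
      refine Set.eq_univ_of_forall fun ω => ?_
      have hR : regret f xstar (fun q => X q ω) (N ^ d) T ≤ 2 * T :=
        regret_le_two_mul hf hxs fun τ hτ => act_mem_cube hrun ω (by omega)
      refine ⟨by linarith, fun hnT => ?_⟩
      have hnT' : n ≤ T := by rw [← hncast]; exact_mod_cast hnT
      rw [regret_add]
      linarith [hinit ω]
    rw [huniv, measure_univ]
    exact ENNReal.ofReal_le_one.2 (by linarith)

/-! ### Tuning the number of bins -/

/-- The rate of the tuned algorithm without the factor `√(log (T / δ))`. -/
def tunedRate (d α T : ℝ) : ℝ :=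
  T ^ ((d + α) / (d + 2 * α)) * Real.log T ^ (2 * α / (d + 2 * α))

/-- With `U = T / ln²T` the right-hand side is the order of `ε T` when `n` is of order `U ^ (d / (d
+ 2α))`. -/
lemma tunedRate_eq {d α T : ℝ} (hd : 1 ≤ d) (hα : 0 < α) (hT : 2 ≤ T) :
    tunedRate d α T = T * (T / Real.log T ^ 2) ^ (-(α / (d + 2 * α))) := by
  have hl := two_thirds_le_log hT
  have hT0 : 0 < T := by linarith
  have hl0 : 0 < Real.log T := by linarith
  have he : 0 < d + 2 * α := by linarith
  rw [tunedRate, Real.rpow_neg (by positivity), Real.div_rpow hT0.le (by positivity), inv_div,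
    ← Real.rpow_natCast (Real.log T) 2, ← Real.rpow_mul hl0.le, div_eq_mul_inv (_ ^ _) (_ ^ _),
    ← Real.rpow_neg hT0.le, mul_left_comm, mul_comm (T ^ _) (_ ^ _)]
  congr 1
  · congr 1
    push_cast
    ring
  · have h1 : (d + α) / (d + 2 * α) = 1 + -(α / (d + 2 * α)) := by
      field_simp
      ring
    have h2 : 0 < (d + α) / (d + 2 * α) := by positivity
    rw [h1] at h2 ⊢
    rw [Real.rpow_one_add' hT0.le h2.ne']

/-- The other half of the balance: for the same `n`, the rate is also the order of `ln T √(Tn)`. -/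
lemma tunedRate_sq {d α T : ℝ} (hd : 1 ≤ d) (hα : 0 < α) (hT : 2 ≤ T) :
    tunedRate d α T ^ 2
      = T * (T / Real.log T ^ 2) ^ (d / (d + 2 * α)) * Real.log T ^ 2 := by
  have hl := two_thirds_le_log hT
  have hT0 : 0 < T := by linarith
  have hl0 : 0 < Real.log T := by linarith
  have he : 0 < d + 2 * α := by linarith
  set U := T / Real.log T ^ 2 with hU
  have hU0 : 0 < U := by positivity
  have h1 : T = U * Real.log T ^ 2 := by rw [hU]; field_simp
  have h2 : (U ^ (-(α / (d + 2 * α)))) ^ 2 * U = U ^ (d / (d + 2 * α)) := by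
    rw [← Real.rpow_natCast, ← Real.rpow_mul hU0.le, ← Real.rpow_add_one hU0.ne']
    congr 1
    push_cast
    field_simp
    ring
  rw [tunedRate_eq hd hα hT, ← hU, mul_pow, ← h2]
  have h3 : T ^ 2 = T * (U * Real.log T ^ 2) := by rw [← h1, sq]
  rw [h3]
  ring

lemma log_sq_le {T : ℝ} (hT : 2 ≤ T) : Real.log T ^ 2 ≤ 4 * T := by
  have hT0 : 0 < T := by linarith
  have hs := Real.sqrt_pos.2 hT0
  have h1 := Real.log_le_sub_one_of_pos hs
  rw [Real.log_sqrt hT0.le] at h1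
  have h2 := two_thirds_le_log hT
  calc Real.log T ^ 2 ≤ (2 * √T) ^ 2 := by
        refine pow_le_pow_left₀ (by linarith) (by linarith) 2
    _ = 4 * T := by rw [mul_pow, Real.sq_sqrt hT0.le]; norm_num

lemma tunedRate_le {d α T : ℝ} (hd : 1 ≤ d) (hα : 0 < α) (hT : 2 ≤ T) :
    tunedRate d α T ≤ 4 * T := by
  have hl := two_thirds_le_log hT
  have hl0 : 0 < Real.log T := by linarith
  have he : 0 < d + 2 * α := by linarith
  rw [tunedRate_eq hd hα hT, mul_comm 4]
  gcongr
  have hU : 1 / 4 ≤ T / Real.log T ^ 2 := by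
    rw [le_div_iff₀ (by positivity)]
    linarith [log_sq_le hT]
  have ha : α / (d + 2 * α) ≤ 1 := by rw [div_le_one he]; linarith
  calc (T / Real.log T ^ 2) ^ (-(α / (d + 2 * α))) ≤ (1 / 4 : ℝ) ^ (-(α / (d + 2 * α))) :=
        Real.rpow_le_rpow_of_nonpos (by norm_num) hU (by rw [neg_nonpos]; positivity)
    _ ≤ (1 / 4 : ℝ) ^ (-(1 : ℝ)) :=
        Real.rpow_le_rpow_of_exponent_ge (by norm_num) (by norm_num) (by linarith)
    _ = 4 := by rw [Real.rpow_neg_one]; norm_num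

/-- Substituting the tuned number of bins into the general bound. -/
lemma tuned_bound_le {d α T δ n ε d' c₂ c₃ : ℝ} (hd : 1 ≤ d) (hα : 0 < α)
    (hT : 2 ≤ T) (hδ : 0 < δ) (hδ1 : δ < 1) (hn : 1 ≤ n) (hd' : 1 ≤ d') (hc₂ : 0 < c₂)
    (hc₃ : 0 ≤ c₃) (hn₂ : n ≤ c₂ * (T / Real.log T ^ 2) ^ (d / (d + 2 * α)))
    (hε : ε ≤ c₃ * (T / Real.log T ^ 2) ^ (-(α / (d + 2 * α)))) :
    d' * Real.log T * √(T * n * Real.log (T ^ 2 * n / δ)) + d' * ε * T * √(Real.log T)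
      ≤ (√(c₂ * (5 + 2 * Real.log (max 1 c₂))) + c₃) * (d' * tunedRate d α T
        * √(Real.log (T / δ))) ∧
    2 * n ≤ 36 * c₂ * (d' * tunedRate d α T * √(Real.log (T / δ))) := by
  have hl := two_thirds_le_log hT
  have hT0 : 0 < T := by linarith
  have hY4 := tunedRate_le hd hα hT
  have hY2 := tunedRate_sq hd hα hT
  have hY1 := tunedRate_eq hd hα hT
  have hY0 : 0 ≤ tunedRate d α T := by
    unfold tunedRate
    have : 0 ≤ Real.log T := by linarith
    positivity
  set Y := tunedRate d α T
  have he : 0 < d + 2 * α := by linarith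
  have hUT : T / Real.log T ^ 2 ≤ T ^ 3 := by
    rw [div_le_iff₀ (by nlinarith)]
    have h1 : 4 / 9 ≤ Real.log T ^ 2 := by nlinarith
    have h2 : 4 * T ≤ T ^ 3 := by nlinarith [mul_le_mul hT hT (by norm_num) hT0.le]
    nlinarith
  have hUn : (T / Real.log T ^ 2) ^ (d / (d + 2 * α)) ≤ T ^ 3 := by
    have hT3 : 1 ≤ T ^ 3 := one_le_pow₀ (by linarith)
    calc _ ≤ (T ^ 3) ^ (d / (d + 2 * α)) := by gcongr
      _ ≤ (T ^ 3) ^ (1 : ℝ) := by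
          refine Real.rpow_le_rpow_of_exponent_le hT3 ?_
          rw [div_le_one he]
          linarith
      _ = T ^ 3 := Real.rpow_one _
  set V := (T / Real.log T ^ 2) ^ (d / (d + 2 * α))
  have hlδ : 0 ≤ Real.log (1 / δ) := Real.log_nonneg (by rw [le_div_iff₀ hδ]; linarith)
  have hΛ : Real.log (T / δ) = Real.log T + Real.log (1 / δ) := by
    rw [← Real.log_mul (by positivity) (by positivity), mul_one_div]
  -- The crude bound `n ≤ max 1 c₂ * T ^ 3` makes the argument at most `T ^ 5 * max 1 c₂ / δ`. The
  -- factor `2` on `log (max 1 c₂)` uses `log (T / δ) ≥ 1/2`.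
  have hG : Real.log (T ^ 2 * n / δ) ≤ (5 + 2 * Real.log (max 1 c₂)) * Real.log (T / δ) := by
    have hm : 0 < max 1 c₂ := by positivity
    have hlm : 0 ≤ Real.log (max 1 c₂) := Real.log_nonneg (le_max_left _ _)
    have h1 : T ^ 2 * n / δ ≤ T ^ 5 * max 1 c₂ * (1 / δ) := by
      rw [div_eq_mul_one_div]
      have : n ≤ max 1 c₂ * T ^ 3 :=
        hn₂.trans (mul_le_mul (le_max_right _ _) hUn (by positivity) hm.le)
      have h2 := mul_le_mul_of_nonneg_left this (by positivity : 0 ≤ T ^ 2)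
      exact mul_le_mul_of_nonneg_right (by linarith) (by positivity)
    refine (Real.log_le_log (by positivity) h1).trans ?_
    rw [Real.log_mul (by positivity) (by positivity), Real.log_mul (by positivity) hm.ne',
      Real.log_pow, hΛ]
    push_cast
    nlinarith
  have hG0 : 0 ≤ Real.log (T ^ 2 * n / δ) := by
    linarith [two_mul_log_le_log hn hT hδ hδ1]
  set Λ := Real.log (T / δ)
  have hlΛ : Real.log T ≤ Λ := by linarith
  set l := Real.log T
  set b := 5 + 2 * Real.log (max 1 c₂)
  have hl0 : 0 < l := by linarith
  have hΛ0 : 0 < Λ := by linarith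
  have hd0 : 0 < d' := by linarith
  constructor
  · have h1 : l * √(T * n * Real.log (T ^ 2 * n / δ)) ≤ √(c₂ * b) * (Y * √Λ) := by
      have hb : 0 ≤ b := by
        have := Real.log_nonneg (le_max_left 1 c₂)
        positivity
      have hsq : √(c₂ * b) * (Y * √Λ) = √(c₂ * b * (Y ^ 2 * Λ)) := by
        rw [Real.sqrt_mul (by positivity) (Y ^ 2 * Λ), Real.sqrt_mul (sq_nonneg Y),
          Real.sqrt_sq hY0]
      have hsl : l * √(T * n * Real.log (T ^ 2 * n / δ))
          = √(l ^ 2 * (T * n * Real.log (T ^ 2 * n / δ))) := by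
        rw [Real.sqrt_mul (sq_nonneg l), Real.sqrt_sq hl0.le]
      rw [hsq, hsl]
      refine Real.sqrt_le_sqrt ?_
      calc l ^ 2 * (T * n * Real.log (T ^ 2 * n / δ))
          ≤ l ^ 2 * (T * (c₂ * V) * (b * Λ)) := by
            refine mul_le_mul_of_nonneg_left (mul_le_mul ?_ hG hG0 (by positivity)) (sq_nonneg l)
            exact mul_le_mul_of_nonneg_left hn₂ hT0.le
        _ = c₂ * b * (Y ^ 2 * Λ) := by rw [hY2]; ring
    have h2 : ε * T * √l ≤ c₃ * (Y * √Λ) := by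
      calc ε * T * √l ≤ c₃ * (T / l ^ 2) ^ (-(α / (d + 2 * α))) * T * √Λ := by gcongr
        _ = c₃ * (Y * √Λ) := by rw [hY1]; ring
    have h3 := mul_le_mul_of_nonneg_left (add_le_add h1 h2) hd0.le
    linarith
  -- From `Y² = T V l²` and `Y ≤ 4T` follows `V l² ≤ 4Y`, and `l² ≥ 4/9`.
  · have h1 : n ≤ 9 * c₂ * Y := by
      have h2 : V * T * l ^ 2 ≤ 4 * T * Y := by
        have : Y ^ 2 ≤ 4 * T * Y := by rw [sq]; gcongr
        linarith
      have h3 : V * l ^ 2 ≤ 4 * Y := by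
        refine le_of_mul_le_mul_right ?_ hT0
        linarith
      have h4 : 4 / 9 ≤ l ^ 2 := by nlinarith
      have hV0 : 0 ≤ V := by positivity
      have h5 : V ≤ 9 * Y := by nlinarith
      calc n ≤ c₂ * V := hn₂
        _ ≤ c₂ * (9 * Y) := by gcongr
        _ = _ := by ring
    have hsΛ : (1 / 2 : ℝ) ≤ √Λ := Real.le_sqrt_of_sq_le (by linarith)
    have hdΛ : 1 / 2 ≤ d' * √Λ := by nlinarith
    have h6 := mul_le_mul_of_nonneg_left hdΛ (by positivity : 0 ≤ c₂ * Y)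
    linarith

/-- The rate for a number of bins of order `(T / (log T) ^ 2) ^ (d / (d + 2 α))`. -/
lemma exists_tuned_regret_bound (α L : ℝ) (σ : ℝ≥0) (hα : 0 < α) (hL : 0 < L) (hσ : 0 < σ)
    (c₁ c₂ : ℝ) (hc₁ : 0 < c₁) (hc₂ : 0 < c₂) : ∃ C : ℝ, 0 < C ∧
      ∀ (d N T : ℕ) (δ : ℝ), 1 ≤ d → 1 ≤ N → 2 ≤ T → 0 < δ → δ < 1 →
        c₁ * ((T : ℝ) / Real.log T ^ 2) ^ (1 / ((d : ℝ) + 2 * α)) ≤ (N : ℝ) →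
        (N : ℝ) ^ d ≤ c₂ * ((T : ℝ) / Real.log T ^ 2) ^ ((d : ℝ) / ((d : ℝ) + 2 * α)) →
      ∀ (f : (Fin d → ℝ) → ℝ) (xstar : Fin d → ℝ),
        (∀ x ∈ cube d, |f x| ≤ 1) → IsHolder α L f → xstar ∈ cube d →
      ∀ (Ω : Type*) [mΩ : MeasurableSpace Ω] (μ : Measure Ω) [IsProbabilityMeasure μ]
        (ℱ : Filtration ℕ mΩ) (η : ℕ → Ω → ℝ) (X : ℕ → Ω → Fin d → ℝ)
        (K : ℕ → Ω → Fin (N ^ d)),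
        IsNoise μ ℱ σ η → IsRun ℱ α L σ δ T f η X K →
        ENNReal.ofReal (1 - δ) ≤
          μ {ω | regret f xstar (fun q => X q ω) 0 (N ^ d + T) ≤
            C * (linDim d α : ℝ)
              * (T : ℝ) ^ (((d : ℝ) + α) / ((d : ℝ) + 2 * α))
              * Real.log T ^ (2 * α / ((d : ℝ) + 2 * α))
              * Real.sqrt (Real.log (T / δ))} := by
  obtain ⟨C, hC, h⟩ := exists_regret_bound α L σ hα hL hσ
  set c₃ := L * c₁ ^ (-α) with hc₃
  refine ⟨C * (√(c₂ * (5 + 2 * Real.log (max 1 c₂))) + c₃) + 36 * c₂, by positivity, ?_⟩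
  intro d N T δ hd hN hT hδ hδ1 hN₁ hN₂ f xstar hf hH hxs Ω mΩ μ _ ℱ η X K hη hrun
  refine (h d N T δ hd hN hT hδ hδ1 f xstar hf hH hxs Ω μ ℱ η X K hη hrun).trans
    (measure_mono fun ω hω => ?_)
  have hT' : (2 : ℝ) ≤ T := by exact_mod_cast hT
  have hd1 : (1 : ℝ) ≤ d := by exact_mod_cast hd
  have hN0 : (0 : ℝ) < N := by exact_mod_cast hN
  have he : (0 : ℝ) < d + 2 * α := by linarith
  have hl := two_thirds_le_log hT'
  have hU : 0 < (T : ℝ) / Real.log T ^ 2 := by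
    have : 0 < Real.log (T : ℝ) := by linarith
    positivity
  have hε : L * ((N : ℝ) ^ d) ^ (-(α / (d : ℝ)))
      ≤ c₃ * ((T : ℝ) / Real.log T ^ 2) ^ (-(α / ((d : ℝ) + 2 * α))) := by
    have h1 := misspec_eq (N := N) hd α L
    rw [misspec, Nat.cast_pow] at h1
    rw [h1, hc₃, mul_assoc]
    gcongr
    calc (N : ℝ) ^ (-α) ≤ (c₁ * ((T : ℝ) / Real.log T ^ 2) ^ (1 / ((d : ℝ) + 2 * α))) ^ (-α) :=
          Real.rpow_le_rpow_of_nonpos (by positivity) hN₁ (by linarith)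
      _ = _ := by
          rw [Real.mul_rpow hc₁.le (by positivity), ← Real.rpow_mul hU.le]
          congr 2
          ring
  obtain ⟨h1, h2⟩ := tuned_bound_le (d := d) (d' := linDim d α) (n := (N : ℝ) ^ d) hd1 hα hT' hδ
    hδ1 (one_le_pow₀ (by exact_mod_cast hN)) (by exact_mod_cast one_le_linDim hd α) hc₂
    (by positivity) hN₂ hε
  -- The initial queries are charged separately, since `n ≤ T` may fail when `c₂` is large.
  have hinit : regret f xstar (fun q => X q ω) 0 (N ^ d) ≤ 2 * (N : ℝ) ^ d := by
    rw [← Nat.cast_pow]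
    exact regret_le_two_mul hf hxs fun τ hτ => act_mem_cube hrun ω (by omega)
  have h3 := mul_le_mul_of_nonneg_left h1 hC.le
  have h4 := hω.1
  rw [tunedRate] at h2 h3
  change regret f xstar (fun q => X q ω) 0 (N ^ d + T) ≤ _
  rw [regret_add]
  linarith

end HolderBandit

end

theorem theorem2 (α L : ℝ) (σ : ℝ≥0) (hα : 0 < α) (hL : 0 < L) (hσ : 0 < σ) :
    -- the bound for an arbitrary number `n = N ^ d` of bins
    (∃ C : ℝ, 0 < C ∧
      ∀ (d N T : ℕ) (δ : ℝ), 1 ≤ d → 1 ≤ N → 2 ≤ T → 0 < δ → δ < 1 →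
      ∀ (f : (Fin d → ℝ) → ℝ) (xstar : Fin d → ℝ),
        (∀ x ∈ HolderBandit.cube d, |f x| ≤ 1) → HolderBandit.IsHolder α L f →
        xstar ∈ HolderBandit.cube d → IsMaxOn f (HolderBandit.cube d) xstar →
      ∀ (Ω : Type*) [mΩ : MeasurableSpace Ω] (μ : Measure Ω) [IsProbabilityMeasure μ]
        (ℱ : Filtration ℕ mΩ) (η : ℕ → Ω → ℝ) (X : ℕ → Ω → Fin d → ℝ)
        (K : ℕ → Ω → Fin (N ^ d)),
        HolderBandit.IsNoise μ ℱ σ η → HolderBandit.IsRun ℱ α L σ δ T f η X K →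
        let n : ℝ := (N : ℝ) ^ d
        let ε : ℝ := L * n ^ (-(α / (d : ℝ)))
        let d' : ℝ := (HolderBandit.linDim d α : ℝ)
        let bound : ℝ := C *
          (d' * Real.log T * Real.sqrt (T * n * Real.log ((T : ℝ) ^ 2 * n / δ))
            + d' * ε * T * Real.sqrt (Real.log T))
        ENNReal.ofReal (1 - δ) ≤
          μ {ω | HolderBandit.regret f xstar (fun q => X q ω) (N ^ d) T ≤ bound ∧
            (N ^ d ≤ T →
              HolderBandit.regret f xstar (fun q => X q ω) 0 (N ^ d + T) ≤ bound)}) ∧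
    -- the rate for `n` of order `(T / (ln T) ^ 2) ^ (d / (d + 2 α))`
    (∀ c₁ c₂ : ℝ, 0 < c₁ → 0 < c₂ → ∃ C : ℝ, 0 < C ∧
      ∀ (d N T : ℕ) (δ : ℝ), 1 ≤ d → 1 ≤ N → 2 ≤ T → 0 < δ → δ < 1 →
        c₁ * ((T : ℝ) / Real.log T ^ 2) ^ (1 / ((d : ℝ) + 2 * α)) ≤ (N : ℝ) →
        (N : ℝ) ^ d ≤ c₂ * ((T : ℝ) / Real.log T ^ 2) ^ ((d : ℝ) / ((d : ℝ) + 2 * α)) →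
      ∀ (f : (Fin d → ℝ) → ℝ) (xstar : Fin d → ℝ),
        (∀ x ∈ HolderBandit.cube d, |f x| ≤ 1) → HolderBandit.IsHolder α L f →
        xstar ∈ HolderBandit.cube d → IsMaxOn f (HolderBandit.cube d) xstar →
      ∀ (Ω : Type*) [mΩ : MeasurableSpace Ω] (μ : Measure Ω) [IsProbabilityMeasure μ]
        (ℱ : Filtration ℕ mΩ) (η : ℕ → Ω → ℝ) (X : ℕ → Ω → Fin d → ℝ)
        (K : ℕ → Ω → Fin (N ^ d)),
        HolderBandit.IsNoise μ ℱ σ η → HolderBandit.IsRun ℱ α L σ δ T f η X K →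
        ENNReal.ofReal (1 - δ) ≤
          μ {ω | HolderBandit.regret f xstar (fun q => X q ω) 0 (N ^ d + T) ≤
            C * (HolderBandit.linDim d α : ℝ)
              * (T : ℝ) ^ (((d : ℝ) + α) / ((d : ℝ) + 2 * α))
              * Real.log T ^ (2 * α / ((d : ℝ) + 2 * α))
              * Real.sqrt (Real.log (T / δ))}) := by
  refine ⟨?_, fun c₁ c₂ hc₁ hc₂ => ?_⟩
  · obtain ⟨C, hC, h⟩ := HolderBandit.exists_regret_bound α L σ hα hL hσ
    exact ⟨C, hC, fun d N T δ hd hN hT hδ hδ1 f xstar hf hH hxs _ =>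
      h d N T δ hd hN hT hδ hδ1 f xstar hf hH hxs⟩
  · obtain ⟨C, hC, h⟩ := HolderBandit.exists_tuned_regret_bound α L σ hα hL hσ c₁ c₂ hc₁ hc₂
    exact ⟨C, hC, fun d N T δ hd hN hT hδ hδ1 hN₁ hN₂ f xstar hf hH hxs _ =>
      h d N T δ hd hN hT hδ hδ1 hN₁ hN₂ f xstar hf hH hxs⟩
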